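/- **Setting.** For $n\in\mathbb Z^2$ let $\Gamma(n)=\{(n_1,n_2,n_3)\in(\mathbb Z^2)^3: n_1-n_2+n_3=n,\ n_1,n_3\neq n\}$, $\omega_4=|n_1|^2-|n_2|^2+|n_3|^2-|n|^2$, and $\Gamma_{res}(n)=\{(n_1,n_2,n_3)\in\Gamma(n):\omega_4=0\}$. Consider the systems $$(\mathcal FNLS)\quad -i\partial_t c_n=-|c_n|^2c_n+\sum_{\Gamma(n)}c_{n_1}\overline{c_{n_2}}c_{n_3}e^{i\omega_4t},\qquad (\mathcal{RF}NLS)\quad -i\partial_t \tilde c_n=-|\tilde c_n|^2\tilde c_n+\sum_{\Gamma_{res}(n)}\tilde c_{n_1}\overline{\tilde c_{n_2}}\tilde c_{n_3}\qquad(n\in\mathbb Z^2).$$ A solution on $[0,T]$ is an element of $C([0,T];l^1(\mathbb Z^2))$ each of whose coefficients is differentiable on $[0,T]$ (one-sidedly at the end points) and satisfies its equation there. Rectangles are nondegenerate. Let $\Lambda=\Lambda_1\cup\dots\cup\Lambda_P\subset\mathbb Z^2$ be a finite disjoint union, with $P>1$. A *nuclear family* is a rectangle with consecutive vertices $(n_1,n_2,n_3,n_4)$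 such that, for some $1\le j<P$, the parents $n_1,n_3$ lie in $\Lambda_j$ and the children $n_2,n_4$ lie in $\Lambda_{j+1}$; then $n_1,n_3$ are spouses and $n_2,n_4$ are siblings. For $\Lambda$ and initial data $\tilde c(0)$, Properties I–VIII are: * I: $\tilde c_n(0)=0$ unless $n\in\Lambda$. * II: if three vertices of a rectangle are in $\Lambda$, so is the fourth. * III: for $1\le j<P$, each $n_1\in\Lambda_j$ has a unique spouse $n_3\in\Lambda_j$ and unique (up to order) children $n_2,n_4\in\Lambda_{j+1}$ such that $(n_1,n_2,n_3,n_4)$ is a nuclear family. * IV: for $1\le j<P$, each $n_2\in\Lambda_{j+1}$ has a unique sibling $n_4\in\Lambda_{j+1}$ and unique (up to order) parents $n_1,n_3\in\Lambda_j$ such that $(n_1,n_2,n_3,n_4)$ is a nuclear family. * V: the sibling of a frequency is never equal to its spouse. * VI: $\Lambda$ contains no rectangles other than nuclear families. * VII: $n\mapsto\tilde c_n(0)$ is constant on each $\Lambda_j$. * VIII: $\Lambda$ contains at most one vertex of any rectangle having a vertex at $0$. **Lemma 3.1.** Let $0<\sigma<1$. There are $\kappa,\varepsilon>0$ depending only on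 $\sigma$ such that for every $A\in\mathbb C\setminus\{0\}$ there are $B_0$ and $C$, depending only on $\sigma$ and $A$, with the following property. Let $B\ge B_0$ be real, let $N\in\mathbb N$ satisfy $B^{1+\sigma}\le\kappa N$, and let $0\le T\le\varepsilon B^2\log B$. Let $\tilde c$ be a solution of $(\mathcal{RF}NLS)$ on $[0,T]$ and let $\Lambda\subset N\mathbb Z^2\setminus\{0\}$ be a finite set such that Properties I–VIII hold and $$\|\tilde c(t)\|_{l^1(\mathbb Z^2)}\le B^{-1}\qquad\text{for all }0\le t\le T.$$ Then $(\mathcal FNLS)$ has a solution $c$ on $[0,T]$ with initial data $c_0(0)=A$ and $c_n(0)=\tilde c_n(0)$ for $n\ne0$, and every such solution satisfies $$\sum_{n\in\Lambda}|c_n(t)-\tilde c_n(t)|\le C\,\frac{B^{1+\sigma}}{N^2}\qquad\text{for all }0\le t\le T.$$ -/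

import Mathlib

/-- Frequencies: points of the lattice `ℤ²`. -/
abbrev Freq : Type := ℤ × ℤ

/-- The Banach space `ℓ¹(ℤ²)` of complex sequences indexed by frequencies; `‖a‖ = ∑ₙ |aₙ|`. -/
abbrev EllOne : Type := lp (fun _ : Freq => ℂ) 1

/-- The scalar product of two frequencies. -/
def Freq.dot (m n : Freq) : ℤ := m.1 * n.1 + m.2 * n.2

/-- `|n|²`. -/
def Freq.normSq (n : Freq) : ℤ := Freq.dot n n

/-- The resonance factor `ω₄ = |n₁|² - |n₂|² + |n₃|² - |n|²`, for `k = (n₁, n₂, n₃)`. -/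
def omegaFour (n : Freq) (k : Freq × Freq × Freq) : ℤ :=
  k.1.normSq - k.2.1.normSq + k.2.2.normSq - n.normSq

/-- `Γ(n)`: the triples `(n₁, n₂, n₃)` with `n₁ - n₂ + n₃ = n` and `n₁, n₃ ≠ n`. -/
def nlsGamma (n : Freq) : Set (Freq × Freq × Freq) :=
  {k | k.1 - k.2.1 + k.2.2 = n ∧ k.1 ≠ n ∧ k.2.2 ≠ n}

/-- `Γ_res(n)`: the triples of `Γ(n)` with `ω₄ = 0`. -/
def nlsGammaRes (n : Freq) : Set (Freq × Freq × Freq) :=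
  {k | k ∈ nlsGamma n ∧ omegaFour n k = 0}

/-- The right-hand side of the equation for `-i ∂ₜ aₙ` in the system `FNLS`. (For a sequence in
`ℓ¹` the sum converges absolutely.) -/
noncomputable def fnlsRHS (t : ℝ) (a : Freq → ℂ) (n : Freq) : ℂ :=
  -(a n * (‖a n‖ : ℂ) ^ 2) +
    ∑' k : nlsGamma n, a k.1.1 * starRingEnd ℂ (a k.1.2.1) * a k.1.2.2 *
      Complex.exp (Complex.I * ((omegaFour n k.1 : ℤ) : ℂ) * (t : ℂ))

/-- The right-hand side of the equation for `-i ∂ₜ rₙ` in the resonant system `RFNLS`. -/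
noncomputable def rfnlsRHS (a : Freq → ℂ) (n : Freq) : ℂ :=
  -(a n * (‖a n‖ : ℂ) ^ 2) +
    ∑' k : nlsGammaRes n, a k.1.1 * starRingEnd ℂ (a k.1.2.1) * a k.1.2.2

/-- `c ∈ C([0,T]; ℓ¹(ℤ²))` solves `-i ∂ₜ cₙ = F(t, c)ₙ` on `[0,T]`, for every `n`, classically
(with one-sided derivatives at the end points). -/
structure IsSolutionOn (F : ℝ → (Freq → ℂ) → Freq → ℂ) (T : ℝ) (c : ℝ → EllOne) : Prop where
  continuousOn : ContinuousOn c (Set.Icc 0 T)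
  hasDeriv : ∀ t ∈ Set.Icc 0 T, ∀ n : Freq,
    HasDerivWithinAt (fun s => c s n) (Complex.I * F t (c t) n) (Set.Icc 0 T) t

/-- `c` solves `FNLS` on `[0,T]`. -/
def SolvesFNLS (T : ℝ) (c : ℝ → EllOne) : Prop := IsSolutionOn fnlsRHS T c

/-- `c` solves `RFNLS` on `[0,T]`. -/
def SolvesRFNLS (T : ℝ) (c : ℝ → EllOne) : Prop := IsSolutionOn (fun _ => rfnlsRHS) T c

/-- `n₁, n₂, n₃, n₄` are, in this cyclic order, the vertices of a (nondegenerate) rectangle. -/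
def IsRectangle (n₁ n₂ n₃ n₄ : Freq) : Prop :=
  n₁ + n₃ = n₂ + n₄ ∧ Freq.dot (n₁ - n₂) (n₃ - n₂) = 0 ∧ n₁ ≠ n₂ ∧ n₃ ≠ n₂

/-- The union `Λ₁ ∪ ... ∪ Λ_P` of the generations. -/
def allGenerations (P : ℕ) (gen : ℕ → Finset Freq) : Finset Freq :=
  (Finset.Icc 1 P).biUnion gen

/-- `(n₁, n₂, n₃, n₄)` is a nuclear family with parents `n₁, n₃` in the `j`-th generation and
children `n₂, n₄` in the next one. -/
def IsNuclearFamily (P : ℕ) (gen : ℕ → Finset Freq) (j : ℕ) (n₁ n₂ n₃ n₄ : Freq) : Prop :=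
  1 ≤ j ∧ j < P ∧ IsRectangle n₁ n₂ n₃ n₄ ∧
    n₁ ∈ gen j ∧ n₃ ∈ gen j ∧ n₂ ∈ gen (j + 1) ∧ n₄ ∈ gen (j + 1)

/-- The properties of the frequency set `Λ = Λ₁ ∪ ... ∪ Λ_P` (disjoint union, `P > 1`,
`Λ_j = gen j`) which do not involve the initial data. -/
structure IsGoodFrequencySet (P : ℕ) (gen : ℕ → Finset Freq) : Prop where
  one_lt : 1 < P
  disjoint_gen : ∀ i ∈ Finset.Icc 1 P, ∀ j ∈ Finset.Icc 1 P, i ≠ j → Disjoint (gen i) (gen j)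
  /-- Closure under completing rectangles. -/
  closure_rectangle : ∀ n₁ n₂ n₃ n₄, IsRectangle n₁ n₂ n₃ n₄ → n₁ ∈ allGenerations P gen →
    n₂ ∈ allGenerations P gen → n₃ ∈ allGenerations P gen → n₄ ∈ allGenerations P gen
  /-- Existence and uniqueness of the spouse and (up to order) the children. -/
  spouse_children : ∀ j, 1 ≤ j → j < P → ∀ n₁ ∈ gen j, ∃ n₂ n₃ n₄,
    IsNuclearFamily P gen j n₁ n₂ n₃ n₄ ∧
      ∀ m₂ m₃ m₄, IsNuclearFamily P gen j n₁ m₂ m₃ m₄ →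
        m₃ = n₃ ∧ ((m₂ = n₂ ∧ m₄ = n₄) ∨ (m₂ = n₄ ∧ m₄ = n₂))
  /-- Existence and uniqueness of the sibling and (up to order) the parents. -/
  sibling_parents : ∀ j, 1 ≤ j → j < P → ∀ n₂ ∈ gen (j + 1), ∃ n₁ n₃ n₄,
    IsNuclearFamily P gen j n₁ n₂ n₃ n₄ ∧
      ∀ m₁ m₃ m₄, IsNuclearFamily P gen j m₁ n₂ m₃ m₄ →
        m₄ = n₄ ∧ ((m₁ = n₁ ∧ m₃ = n₃) ∨ (m₁ = n₃ ∧ m₃ = n₁))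
  /-- Nondegeneracy: the sibling `s` of `n` (in the family where `n` is a child) is never the
  spouse `s'` of `n` (in the family where `n` is a parent). -/
  sibling_ne_spouse : ∀ i j n p q s s' x y, IsNuclearFamily P gen i p n q s →
    IsNuclearFamily P gen j n x s' y → s ≠ s'
  /-- Faithfulness: `Λ` contains no rectangles other than the nuclear families. -/
  faithful : ∀ n₁ n₂ n₃ n₄, IsRectangle n₁ n₂ n₃ n₄ → n₁ ∈ allGenerations P gen →
    n₂ ∈ allGenerations P gen → n₃ ∈ allGenerations P gen → n₄ ∈ allGenerations P gen →
    ∃ j, IsNuclearFamily P gen j n₁ n₂ n₃ n₄ ∨ IsNuclearFamily P gen j n₂ n₃ n₄ n₁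
  /-- `Λ` contains at most one vertex of any rectangle having a vertex at `0`. -/
  no_rectangle_zero : ∀ n₁ n₂ n₃, IsRectangle 0 n₁ n₂ n₃ →
    ¬ (n₁ ∈ allGenerations P gen ∧ n₂ ∈ allGenerations P gen) ∧
    ¬ (n₁ ∈ allGenerations P gen ∧ n₃ ∈ allGenerations P gen) ∧
    ¬ (n₂ ∈ allGenerations P gen ∧ n₃ ∈ allGenerations P gen)

/-- The properties of the initial data `a` relative to `Λ`: it vanishes outside `Λ`, and it is
constant on each generation. -/
structure IsAdaptedData (P : ℕ) (gen : ℕ → Finset Freq) (a : Freq → ℂ) : Prop where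
  support : ∀ n, n ∉ allGenerations P gen → a n = 0
  intragenerational : ∀ j ∈ Finset.Icc 1 P, ∀ m ∈ gen j, ∀ n ∈ gen j, a m = a n

/-- The punctured dilated lattice `Nℤ² ∖ {0}`. -/
def puncturedLattice (N : ℕ) : Set Freq :=
  {n | (N : ℤ) ∣ n.1 ∧ (N : ℤ) ∣ n.2 ∧ n ≠ 0}

/-! Split `c = a + b` into the zero mode `a` and the remaining modes `b`, put `β = 1/B`, let `w` be
the resonant solution, and compare `b` with `w`. All the frequencies stay in `Nℤ²`, where `ω₄ = -2
(n₁ - n₂)·(n₃ - n₂)` is a multiple of `N²`.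

Nonresonant interactions oscillate at least as fast as `N²`, so they are integrated by parts in
time: `v` is `b` minus the primitive of the fast part. Every interaction with nonzero output
contains a nonzero mode, so `v` differs from `b` only by `O(β/N²)`, and its equation has a forcing
of the same size.

Resonant interactions with nonzero output contain at most one zero mode (`trilin_slow_eq`). Those
with exactly one form `quadraticPart`. Property VIII makes it vanish at `w`
(`IsGoodFrequencySet.zeroDecoupled`), so it is `O(|A| β ‖v - w‖)`. This rate is still too large: on
times of order `B² log B`, Gronwall would cost `exp(O(B log B))`. But the zero mode rotates like
`exp(-i|A|²t)`: conservation of mass gives `|c₀|² = |A|² + O(β²)`, and the other contributions to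
its equation are quadratic in `b`. Adding `|A|⁻²` times `quadraticCorrector` to `v - w` cancels
`quadraticPart`. The terms this creates gain from Property VIII once more, since `w` and its
derivative are both supported in `Λ`, and the rate drops to `O(β²)` (`norm_rotating_rate_le`,
`norm_sub_le_of_rotating`).

Gronwall with forcing `O(β/N²)`, rate `3000 β²` and time at most `(σ/3000) B² log B` then gives a
bound of order `(β/N²) / β² · B^σ = B^(1+σ)/N²`. Since `B^(1+σ) ≤ N`, this is far below `β`, which
closes a bootstrap on `‖c‖` and `‖b‖`. The solution itself comes from a radially truncated equation,
which the bootstrap shows to be untruncated. -/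

open Filter Topology

/-- The frequency `n₁ - n₂ + n₃` produced by the interaction of `k = (n₁, n₂, n₃)`. -/
def outFreq (k : Freq × Freq × Freq) : Freq := k.1 - k.2.1 + k.2.2

/-! ### Trilinear operators on `ℓ¹` with bounded symbols. -/

namespace EllOne

theorem summable_norm (x : EllOne) : Summable fun n => ‖x n‖ := by
  simpa using (lp.memℓp x).summable (by simp)

theorem norm_eq_tsum (x : EllOne) : ‖x‖ = ∑' n, ‖x n‖ := by
  have := lp.norm_eq_tsum_rpow (p := 1) (by simp) x
  simpa using this

theorem norm_apply_le (x : EllOne) (n : Freq) : ‖x n‖ ≤ ‖x‖ :=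
  lp.norm_apply_le_norm (by simp) x n

theorem sum_norm_le (x : EllOne) (s : Finset Freq) : ∑ n ∈ s, ‖x n‖ ≤ ‖x‖ := by
  rw [norm_eq_tsum]
  exact x.summable_norm.sum_le_tsum s fun _ _ => norm_nonneg _

theorem ext_apply {x y : EllOne} (h : ∀ n, x n = y n) : x = y := lp.ext (funext h)

@[simp] theorem add_apply (x y : EllOne) (n : Freq) : (x + y) n = x n + y n := rfl
@[simp] theorem sub_apply (x y : EllOne) (n : Freq) : (x - y) n = x n - y n := rfl
@[simp] theorem smul_apply (a : ℂ) (x : EllOne) (n : Freq) : (a • x) n = a * x n := rfl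
@[simp] theorem zero_apply (n : Freq) : (0 : EllOne) n = 0 := rfl

theorem summable_triple (x y z : EllOne) :
    Summable fun k : Freq × Freq × Freq => ‖x k.1‖ * (‖y k.2.1‖ * ‖z k.2.2‖) :=
  x.summable_norm.mul_of_nonneg
    (y.summable_norm.mul_of_nonneg z.summable_norm (fun _ => norm_nonneg _)
      (fun _ => norm_nonneg _))
    (fun _ => norm_nonneg _) (fun _ => mul_nonneg (norm_nonneg _) (norm_nonneg _))

theorem tsum_triple (x y z : EllOne) :
    ∑' k : Freq × Freq × Freq, ‖x k.1‖ * (‖y k.2.1‖ * ‖z k.2.2‖) = ‖x‖ * (‖y‖ * ‖z‖) := by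
  have hyz : Summable fun k : Freq × Freq => ‖y k.1‖ * ‖z k.2‖ :=
    y.summable_norm.mul_of_nonneg z.summable_norm (fun _ => norm_nonneg _)
      (fun _ => norm_nonneg _)
  rw [norm_eq_tsum x, norm_eq_tsum y, norm_eq_tsum z,
    y.summable_norm.tsum_mul_tsum z.summable_norm hyz,
    x.summable_norm.tsum_mul_tsum hyz (summable_triple x y z)]

/-- The contribution of the interaction `k` to the trilinear operator with symbol `φ`. -/
noncomputable def trilinTerm (φ : Freq × Freq × Freq → ℂ) (x y z : EllOne)
    (k : Freq × Freq × Freq) : EllOne :=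
  lp.single 1 (outFreq k) (φ k * (x k.1 * starRingEnd ℂ (y k.2.1) * z k.2.2))

/-- The operator with symbol `φ`, linear in `x` and `z` and conjugate linear in `y`:
`n ↦ ∑ φ(n₁, n₂, n₃) x(n₁) conj y(n₂) z(n₃)` over `n₁ - n₂ + n₃ = n`. -/
noncomputable def trilin (φ : Freq × Freq × Freq → ℂ) (x y z : EllOne) : EllOne :=
  ∑' k, trilinTerm φ x y z k

/-- The symbol `φ` is bounded by `C`. -/
def SymbolBound (φ : Freq × Freq × Freq → ℂ) (C : ℝ) : Prop := ∀ k, ‖φ k‖ ≤ C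

theorem norm_trilinTerm (φ : Freq × Freq × Freq → ℂ) (x y z : EllOne)
    (k : Freq × Freq × Freq) :
    ‖trilinTerm φ x y z k‖ = ‖φ k‖ * (‖x k.1‖ * (‖y k.2.1‖ * ‖z k.2.2‖)) := by
  simp [trilinTerm, lp.norm_single, mul_assoc]

theorem norm_trilinTerm_le {φ : Freq × Freq × Freq → ℂ} {C : ℝ} (h : SymbolBound φ C)
    (x y z : EllOne) (k : Freq × Freq × Freq) :
    ‖trilinTerm φ x y z k‖ ≤ C * (‖x k.1‖ * (‖y k.2.1‖ * ‖z k.2.2‖)) := by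
  rw [norm_trilinTerm]
  exact mul_le_mul_of_nonneg_right (h k) (by positivity)

theorem summable_trilinTerm {φ : Freq × Freq × Freq → ℂ} {C : ℝ} (h : SymbolBound φ C)
    (x y z : EllOne) : Summable (trilinTerm φ x y z) :=
  Summable.of_norm_bounded ((summable_triple x y z).mul_left C) (norm_trilinTerm_le h x y z)

theorem norm_trilin_le {φ : Freq × Freq × Freq → ℂ} {C : ℝ} (h : SymbolBound φ C)
    (x y z : EllOne) : ‖trilin φ x y z‖ ≤ C * (‖x‖ * (‖y‖ * ‖z‖)) := by
  rw [← tsum_triple, ← tsum_mul_left]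
  exact tsum_of_norm_bounded ((summable_triple x y z).mul_left C).hasSum
    (norm_trilinTerm_le h x y z)

/-- Only the symbol on the product of the supports matters; this turns facts about the geometry of
frequencies into identities between operators. -/
theorem trilin_congr {φ ψ : Freq × Freq × Freq → ℂ} {x y z : EllOne}
    (h : ∀ k, x k.1 ≠ 0 → y k.2.1 ≠ 0 → z k.2.2 ≠ 0 → φ k = ψ k) :
    trilin φ x y z = trilin ψ x y z := by
  refine tsum_congr fun k => ?_
  unfold trilinTerm
  by_cases hx : x k.1 = 0
  · simp [hx]
  by_cases hy : y k.2.1 = 0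
  · simp [hy]
  by_cases hz : z k.2.2 = 0
  · simp [hz]
  rw [h k hx hy hz]

theorem trilin_eq_zero {φ : Freq × Freq × Freq → ℂ} {x y z : EllOne}
    (h : ∀ k, x k.1 ≠ 0 → y k.2.1 ≠ 0 → z k.2.2 ≠ 0 → φ k = 0) :
    trilin φ x y z = 0 := by
  rw [trilin_congr (ψ := fun _ => 0) h]
  simp [trilin, trilinTerm]

theorem trilin_apply {φ : Freq × Freq × Freq → ℂ} {C : ℝ} (h : SymbolBound φ C)
    (x y z : EllOne) (n : Freq) :
    trilin φ x y z n = ∑' k : Freq × Freq × Freq,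
      if outFreq k = n then φ k * (x k.1 * starRingEnd ℂ (y k.2.1) * z k.2.2) else 0 := by
  have := (lp.evalCLM ℂ (fun _ : Freq => ℂ) 1 n).map_tsum (summable_trilinTerm h x y z)
  refine this.trans (tsum_congr fun k => ?_)
  change trilinTerm φ x y z k n = _
  by_cases hk : outFreq k = n
  · subst hk
    simp [trilinTerm]
  · rw [if_neg hk, trilinTerm, lp.single_apply_ne _ _ _ (Ne.symm hk)]

theorem trilin_apply_eq_zero {φ : Freq × Freq × Freq → ℂ} {C : ℝ} (h : SymbolBound φ C)
    {x y z : EllOne} {n : Freq}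
    (hn : ∀ k, outFreq k = n → x k.1 ≠ 0 → y k.2.1 ≠ 0 → z k.2.2 ≠ 0 → φ k = 0) :
    trilin φ x y z n = 0 := by
  rw [trilin_apply h]
  refine (tsum_congr fun k => ?_).trans tsum_zero
  split_ifs with hk
  · by_cases hx : x k.1 = 0
    · simp [hx]
    by_cases hy : y k.2.1 = 0
    · simp [hy]
    by_cases hz : z k.2.2 = 0
    · simp [hz]
    rw [hn k hk hx hy hz, zero_mul]
  · rfl

section multilinear

variable {φ ψ : Freq × Freq × Freq → ℂ} {C D : ℝ}

theorem trilin_add_left (h : SymbolBound φ C) (x x' y z : EllOne) :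
    trilin φ (x + x') y z = trilin φ x y z + trilin φ x' y z := by
  rw [trilin, trilin, trilin,
    ← (summable_trilinTerm h x y z).tsum_add (summable_trilinTerm h x' y z)]
  refine tsum_congr fun k => ?_
  simp only [trilinTerm, ← lp.single_add, add_apply]
  congr 1; ring

theorem trilin_add_mid (h : SymbolBound φ C) (x y y' z : EllOne) :
    trilin φ x (y + y') z = trilin φ x y z + trilin φ x y' z := by
  rw [trilin, trilin, trilin,
    ← (summable_trilinTerm h x y z).tsum_add (summable_trilinTerm h x y' z)]
  refine tsum_congr fun k => ?_
  simp only [trilinTerm, ← lp.single_add, add_apply, map_add]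
  congr 1; ring

theorem trilin_add_right (h : SymbolBound φ C) (x y z z' : EllOne) :
    trilin φ x y (z + z') = trilin φ x y z + trilin φ x y z' := by
  rw [trilin, trilin, trilin,
    ← (summable_trilinTerm h x y z).tsum_add (summable_trilinTerm h x y z')]
  refine tsum_congr fun k => ?_
  simp only [trilinTerm, ← lp.single_add, add_apply]
  congr 1; ring

theorem trilin_add_symbol (h : SymbolBound φ C) (h' : SymbolBound ψ D) (x y z : EllOne) :
    trilin (φ + ψ) x y z = trilin φ x y z + trilin ψ x y z := by
  rw [trilin, trilin, trilin,
    ← (summable_trilinTerm h x y z).tsum_add (summable_trilinTerm h' x y z)]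
  refine tsum_congr fun k => ?_
  simp only [trilinTerm, ← lp.single_add, Pi.add_apply]
  congr 1; ring

theorem trilinTerm_eq_smul (a : ℂ) {φ : Freq × Freq × Freq → ℂ} {x y z x' y' z' : EllOne}
    {k : Freq × Freq × Freq} {ψ : Freq × Freq × Freq → ℂ}
    (h : ψ k * (x' k.1 * starRingEnd ℂ (y' k.2.1) * z' k.2.2) =
      a * (φ k * (x k.1 * starRingEnd ℂ (y k.2.1) * z k.2.2))) :
    trilinTerm ψ x' y' z' k = a • trilinTerm φ x y z k := by
  simp only [trilinTerm, ← lp.single_smul, h, smul_eq_mul]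

theorem trilin_eq_smul (a : ℂ) (hφ : SymbolBound φ C) {x y z x' y' z' : EllOne}
    (h : ∀ k, ψ k * (x' k.1 * starRingEnd ℂ (y' k.2.1) * z' k.2.2) =
      a * (φ k * (x k.1 * starRingEnd ℂ (y k.2.1) * z k.2.2))) :
    trilin ψ x' y' z' = a • trilin φ x y z := by
  rw [trilin, trilin, ← (summable_trilinTerm hφ x y z).tsum_const_smul a]
  exact tsum_congr fun k => trilinTerm_eq_smul a (h k)

theorem trilin_smul_left (h : SymbolBound φ C) (a : ℂ) (x y z : EllOne) :
    trilin φ (a • x) y z = a • trilin φ x y z :=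
  trilin_eq_smul a h fun k => by simp only [smul_apply]; ring

theorem trilin_smul_mid (h : SymbolBound φ C) (a : ℂ) (x y z : EllOne) :
    trilin φ x (a • y) z = starRingEnd ℂ a • trilin φ x y z :=
  trilin_eq_smul _ h fun k => by simp only [smul_apply, map_mul]; ring

theorem trilin_smul_right (h : SymbolBound φ C) (a : ℂ) (x y z : EllOne) :
    trilin φ x y (a • z) = a • trilin φ x y z :=
  trilin_eq_smul a h fun k => by simp only [smul_apply]; ring

theorem trilin_smul_symbol (h : SymbolBound φ C) (a : ℂ) (x y z : EllOne) :
    trilin (a • φ) x y z = a • trilin φ x y z :=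
  trilin_eq_smul a h fun k => by simp only [Pi.smul_apply, smul_eq_mul]; ring

theorem trilin_sub_left (h : SymbolBound φ C) (x x' y z : EllOne) :
    trilin φ (x - x') y z = trilin φ x y z - trilin φ x' y z := by
  rw [eq_sub_iff_add_eq, ← trilin_add_left h, sub_add_cancel]

theorem trilin_sub_mid (h : SymbolBound φ C) (x y y' z : EllOne) :
    trilin φ x (y - y') z = trilin φ x y z - trilin φ x y' z := by
  rw [eq_sub_iff_add_eq, ← trilin_add_mid h, sub_add_cancel]

theorem trilin_sub_right (h : SymbolBound φ C) (x y z z' : EllOne) :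
    trilin φ x y (z - z') = trilin φ x y z - trilin φ x y z' := by
  rw [eq_sub_iff_add_eq, ← trilin_add_right h, sub_add_cancel]

theorem SymbolBound.sub (h : SymbolBound φ C) (h' : SymbolBound ψ D) :
    SymbolBound (φ - ψ) (C + D) := fun k => (norm_sub_le _ _).trans (add_le_add (h k) (h' k))

theorem SymbolBound.nonneg (h : SymbolBound φ C) : 0 ≤ C := (norm_nonneg _).trans (h 0)

theorem trilin_sub_symbol (h : SymbolBound φ C) (h' : SymbolBound ψ D) (x y z : EllOne) :
    trilin (φ - ψ) x y z = trilin φ x y z - trilin ψ x y z := by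
  rw [eq_sub_iff_add_eq, ← trilin_add_symbol (h.sub h') h', sub_add_cancel]

theorem trilin_sub_trilin (h : SymbolBound φ C) (x y z x' y' z' : EllOne) :
    trilin φ x' y' z' - trilin φ x y z =
      trilin φ (x' - x) y' z' + trilin φ x (y' - y) z' + trilin φ x y (z' - z) := by
  rw [trilin_sub_left h, trilin_sub_mid h, trilin_sub_right h]
  abel

theorem norm_trilin_sub_trilin_le (h : SymbolBound φ C) (x y z x' y' z' : EllOne) :
    ‖trilin φ x' y' z' - trilin φ x y z‖ ≤
      C * (‖x' - x‖ * (‖y'‖ * ‖z'‖) + ‖x‖ * (‖y' - y‖ * ‖z'‖) + ‖x‖ * (‖y‖ * ‖z' - z‖)) := by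
  rw [trilin_sub_trilin h]
  refine (norm_add₃_le).trans ?_
  have h1 := norm_trilin_le h (x' - x) y' z'
  have h2 := norm_trilin_le h x (y' - y) z'
  have h3 := norm_trilin_le h x y (z' - z)
  linarith

end multilinear

/-! ### Limits, continuity and derivatives of trilinear operators. -/

theorem tendsto_trilin_symbol {ι : Type*} {l : Filter ι} {φ : ι → Freq × Freq × Freq → ℂ}
    {ψ : Freq × Freq × Freq → ℂ} {C : ℝ} (hφ : ∀ᶠ i in l, SymbolBound (φ i) C)
    (hlim : ∀ k, Tendsto (fun i => φ i k) l (𝓝 (ψ k))) (x y z : EllOne) :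
    Tendsto (fun i => trilin (φ i) x y z) l (𝓝 (trilin ψ x y z)) := by
  refine tendsto_tsum_of_dominated_convergence ((summable_triple x y z).mul_left C)
    (fun k => ?_) (hφ.mono fun i hi k => norm_trilinTerm_le hi x y z k)
  have h1 : Tendsto (fun i => φ i k * (x k.1 * starRingEnd ℂ (y k.2.1) * z k.2.2)) l
      (𝓝 (ψ k * (x k.1 * starRingEnd ℂ (y k.2.1) * z k.2.2))) := (hlim k).mul_const _
  exact ((lp.isometry_single (E := fun _ : Freq => ℂ) (p := 1)
    (outFreq k)).continuous.tendsto _).comp h1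

theorem tendsto_trilin {ι : Type*} {l : Filter ι} {φ : ι → Freq × Freq × Freq → ℂ}
    {ψ : Freq × Freq × Freq → ℂ} {C : ℝ} (hφ : ∀ᶠ i in l, SymbolBound (φ i) C)
    (hlim : ∀ k, Tendsto (fun i => φ i k) l (𝓝 (ψ k)))
    {x y z : ι → EllOne} {x₀ y₀ z₀ : EllOne} (hx : Tendsto x l (𝓝 x₀))
    (hy : Tendsto y l (𝓝 y₀)) (hz : Tendsto z l (𝓝 z₀)) :
    Tendsto (fun i => trilin (φ i) (x i) (y i) (z i)) l (𝓝 (trilin ψ x₀ y₀ z₀)) := by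
  have h0 := tendsto_trilin_symbol hφ hlim x₀ y₀ z₀
  suffices h : Tendsto (fun i => trilin (φ i) (x i) (y i) (z i) - trilin (φ i) x₀ y₀ z₀) l
      (𝓝 0) by simpa using h.add h0
  have hb : Tendsto (fun i => C * (‖x i - x₀‖ * (‖y i‖ * ‖z i‖) +
      ‖x₀‖ * (‖y i - y₀‖ * ‖z i‖) + ‖x₀‖ * (‖y₀‖ * ‖z i - z₀‖))) l
      (𝓝 (C * (‖x₀ - x₀‖ * (‖y₀‖ * ‖z₀‖) +
      ‖x₀‖ * (‖y₀ - y₀‖ * ‖z₀‖) + ‖x₀‖ * (‖y₀‖ * ‖z₀ - z₀‖)))) :=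
    ((((hx.sub_const _).norm.mul (hy.norm.mul hz.norm)).add
      (((hy.sub_const _).norm.mul hz.norm).const_mul _)).add
      (((hz.sub_const _).norm.const_mul _).const_mul _)).const_mul _
  rw [sub_self, sub_self, sub_self] at hb
  refine squeeze_zero_norm' (hφ.mono fun i hi => norm_trilin_sub_trilin_le hi _ _ _ _ _ _) ?_
  simpa using hb

theorem continuousOn_trilin {φ : ℝ → Freq × Freq × Freq → ℂ} {C : ℝ} {s : Set ℝ}
    (hφ : ∀ t, SymbolBound (φ t) C) (hc : ∀ k, Continuous fun t => φ t k) {x y z : ℝ → EllOne}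
    (hx : ContinuousOn x s) (hy : ContinuousOn y s) (hz : ContinuousOn z s) :
    ContinuousOn (fun t => trilin (φ t) (x t) (y t) (z t)) s := fun t ht =>
  tendsto_trilin (Eventually.of_forall hφ)
    (fun k => ((hc k).tendsto t).mono_left nhdsWithin_le_nhds) (hx t ht) (hy t ht) (hz t ht)

/-- The difference quotients of the symbol converge for each interaction and are uniformly bounded,
so dominated convergence applies. No uniformity of the convergence over interactions is needed,
which matters because the frequencies of the phases are unbounded. -/
theorem hasDerivWithinAt_trilin {φ φ' : ℝ → Freq × Freq × Freq → ℂ} {C D : ℝ} {s : Set ℝ}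
    {t : ℝ} (hφ : ∀ t, SymbolBound (φ t) C) (hφ' : ∀ t, SymbolBound (φ' t) D)
    (hd : ∀ k t, HasDerivAt (fun t => φ t k) (φ' t k) t)
    {x y z : ℝ → EllOne} {x' y' z' : EllOne}
    (hx : HasDerivWithinAt x x' s t) (hy : HasDerivWithinAt y y' s t)
    (hz : HasDerivWithinAt z z' s t) :
    HasDerivWithinAt (fun t => trilin (φ t) (x t) (y t) (z t))
      (trilin (φ' t) (x t) (y t) (z t) + trilin (φ t) x' (y t) (z t) +
        trilin (φ t) (x t) y' (z t) + trilin (φ t) (x t) (y t) z') s t := by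
  rw [hasDerivWithinAt_iff_tendsto_slope]
  have hle : 𝓝[s \ {t}] t ≤ 𝓝[s] t := nhdsWithin_mono t Set.sdiff_subset
  have hx0 := hx.continuousWithinAt.tendsto.mono_left hle
  have hy0 := hy.continuousWithinAt.tendsto.mono_left hle
  have hz0 := hz.continuousWithinAt.tendsto.mono_left hle
  rw [hasDerivWithinAt_iff_tendsto_slope] at hx hy hz
  have hslope : ∀ k, Tendsto (fun u => ((u - t : ℝ) : ℂ)⁻¹ • (φ u - φ t) <| k)
      (𝓝[s \ {t}] t) (𝓝 (φ' t k)) := fun k => by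
    have := (hd k t).hasDerivWithinAt (s := s)
    rw [hasDerivWithinAt_iff_tendsto_slope] at this
    refine this.congr fun u => ?_
    simp [slope_def_module]
  -- The mean value inequality turns the bound on the derivative of the symbol into one on its
  -- difference quotients.
  have hbound : ∀ u ∈ s \ {t}, SymbolBound (((u - t : ℝ) : ℂ)⁻¹ • (φ u - φ t)) D := by
    intro u hu k
    have hne : u - t ≠ 0 := sub_ne_zero.2 hu.2
    have := Convex.norm_image_sub_le_of_norm_hasDerivWithin_le (𝕜 := ℝ) (s := Set.univ)
      (f := fun t => φ t k) (f' := fun t => φ' t k) (x := t) (y := u) (C := D)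
      (fun v _ => (hd k v).hasDerivWithinAt) (fun v _ => hφ' v k) convex_univ trivial trivial
    simp only [Pi.smul_apply, Pi.sub_apply, smul_eq_mul, norm_mul, norm_inv, Complex.norm_real]
    rw [inv_mul_le_iff₀ (norm_pos_iff.2 hne), mul_comm]
    exact this
  have hmem : ∀ᶠ u in 𝓝[s \ {t}] t, u ∈ s \ {t} := self_mem_nhdsWithin
  have h1 := tendsto_trilin (hmem.mono hbound) hslope hx0 hy0 hz0
  have h2 := tendsto_trilin (Eventually.of_forall fun _ : ℝ => hφ t)
    (fun k => tendsto_const_nhds) hx hy0 hz0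
  have h3 := tendsto_trilin (Eventually.of_forall fun _ : ℝ => hφ t)
    (fun k => tendsto_const_nhds) (tendsto_const_nhds (x := x t)) hy hz0
  have h4 := tendsto_trilin (Eventually.of_forall fun _ : ℝ => hφ t)
    (fun k => tendsto_const_nhds) (tendsto_const_nhds (x := x t))
    (tendsto_const_nhds (x := y t)) hz
  -- The four limits telescope: symbol, `x`, `y`, `z` are moved from `u` to `t` one at a time.
  refine (((h1.add h2).add h3).add h4).congr' (hmem.mono fun u hu => ?_)
  have hsl : ∀ (f : ℝ → EllOne), slope f t u = ((u - t : ℝ) : ℂ)⁻¹ • (f u - f t) := fun f => by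
    rw [slope_def_module, ← Complex.ofReal_inv]
    rfl
  have hstar : starRingEnd ℂ (((u - t : ℝ) : ℂ)⁻¹) = ((u - t : ℝ) : ℂ)⁻¹ := by
    rw [← Complex.ofReal_inv, Complex.conj_ofReal]
  simp only [hsl]
  rw [trilin_smul_symbol ((hφ u).sub (hφ t)), trilin_smul_left (hφ t), trilin_smul_mid (hφ t),
    trilin_smul_right (hφ t), hstar, ← smul_add, ← smul_add, ← smul_add,
    trilin_sub_symbol (hφ u) (hφ t), trilin_sub_left (hφ t), trilin_sub_mid (hφ t),
    trilin_sub_right (hφ t)]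
  congr 1
  abel

end EllOne

/-! ### Frequency cut-offs and supports. -/

open scoped Classical in
/-- The indicator multiplier of a set of frequencies. -/
noncomputable def EllOne.restrict (S : Set Freq) : EllOne →L[ℂ] EllOne :=
  LinearMap.mkContinuous
    { toFun := fun x => ⟨fun n => if n ∈ S then x n else 0, by
        refine (lp.memℓp x).mono' fun n => ?_
        split_ifs
        · exact le_rfl
        · simp⟩
      map_add' := fun x y => EllOne.ext_apply fun n => by
        change (if n ∈ S then x n + y n else 0) =
          (if n ∈ S then x n else 0) + (if n ∈ S then y n else 0)
        split_ifs <;> simp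
      map_smul' := fun a x => EllOne.ext_apply fun n => by
        change (if n ∈ S then a * x n else 0) = a * (if n ∈ S then x n else 0)
        split_ifs <;> simp } 1 fun x => by
    rw [one_mul, EllOne.norm_eq_tsum, EllOne.norm_eq_tsum]
    have hle : ∀ n, ‖(if n ∈ S then x n else 0 : ℂ)‖ ≤ ‖x n‖ := fun n => by
      split_ifs
      · exact le_rfl
      · simp
    exact Summable.tsum_le_tsum hle
      (x.summable_norm.of_nonneg_of_le (fun _ => norm_nonneg _) hle) x.summable_norm

namespace EllOne

open scoped Classical in
theorem restrict_apply (S : Set Freq) (x : EllOne) (n : Freq) :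
    restrict S x n = if n ∈ S then x n else 0 := rfl

theorem restrict_of_mem {S : Set Freq} {n : Freq} (h : n ∈ S) (x : EllOne) :
    restrict S x n = x n := by rw [restrict_apply, if_pos h]

theorem restrict_of_notMem {S : Set Freq} {n : Freq} (h : n ∉ S) (x : EllOne) :
    restrict S x n = 0 := by rw [restrict_apply, if_neg h]

theorem mem_of_restrict_ne_zero {S : Set Freq} {n : Freq} {x : EllOne}
    (h : restrict S x n ≠ 0) : n ∈ S := by
  by_contra hn
  exact h (restrict_of_notMem hn x)

theorem norm_restrict_le (S : Set Freq) (x : EllOne) : ‖restrict S x‖ ≤ ‖x‖ := by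
  simpa using (restrict S).le_of_opNorm_le (LinearMap.mkContinuous_norm_le _ zero_le_one _) x

theorem restrict_add_restrict_compl (S : Set Freq) (x : EllOne) :
    restrict S x + restrict Sᶜ x = x := by
  refine ext_apply fun n => ?_
  by_cases hn : n ∈ S
  · simp [restrict_of_mem hn, restrict_of_notMem (S := Sᶜ) (not_not.2 hn)]
  · simp [restrict_of_notMem hn, restrict_of_mem (S := Sᶜ) hn]

/-- The coefficients of `x` vanish outside `S`. -/
def SupportedIn (S : Set Freq) (x : EllOne) : Prop := ∀ n ∉ S, x n = 0

theorem SupportedIn.mem {S : Set Freq} {x : EllOne} (h : SupportedIn S x) {n : Freq}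
    (hn : x n ≠ 0) : n ∈ S := by
  by_contra hS
  exact hn (h n hS)

theorem supportedIn_restrict (S : Set Freq) (x : EllOne) : SupportedIn S (restrict S x) :=
  fun _ hn => restrict_of_notMem hn x

theorem SupportedIn.smul {S : Set Freq} {x : EllOne} (h : SupportedIn S x) (a : ℂ) :
    SupportedIn S (a • x) := fun n hn => by simp [h n hn]

theorem supportedIn_trilin {φ : Freq × Freq × Freq → ℂ} {C : ℝ} (hφ : SymbolBound φ C)
    {S : Set Freq} {x y z : EllOne} (hx : SupportedIn S x) (hy : SupportedIn S y)
    (hz : SupportedIn S z)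
    (h : ∀ k, k.1 ∈ S → k.2.1 ∈ S → k.2.2 ∈ S → outFreq k ∉ S → φ k = 0) :
    SupportedIn S (trilin φ x y z) := fun _ hn =>
  trilin_apply_eq_zero hφ fun k hk h1 h2 h3 =>
    h k (hx.mem h1) (hy.mem h2) (hz.mem h3) (hk ▸ hn)

/-- The multiplier of `S` applied to the output of a trilinear operator acts on its symbol. -/
theorem restrict_trilin {φ ψ : Freq × Freq × Freq → ℂ} {C D : ℝ} (hφ : SymbolBound φ C)
    (hψ : SymbolBound ψ D) {S : Set Freq} (h : ∀ k, outFreq k ∈ S → ψ k = φ k)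
    (h' : ∀ k, outFreq k ∉ S → ψ k = 0) (x y z : EllOne) :
    restrict S (trilin φ x y z) = trilin ψ x y z := by
  refine ext_apply fun n => ?_
  by_cases hn : n ∈ S
  · rw [restrict_of_mem hn, trilin_apply hφ, trilin_apply hψ]
    refine tsum_congr fun k => ?_
    split_ifs with hk
    · rw [h k (hk ▸ hn)]
    · rfl
  · rw [restrict_of_notMem hn, trilin_apply_eq_zero hψ fun k hk _ _ _ => h' k (hk ▸ hn)]

end EllOne

/-! ### Gronwall estimates. -/

/-- Gronwall's inequality on `[0, T]`, with one-sided derivatives at the end points. -/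
theorem norm_le_gronwallBound_Icc {E : Type*} [NormedAddCommGroup E] [NormedSpace ℝ E]
    {f f' : ℝ → E} {δ K ε T : ℝ}
    (hf : ∀ t ∈ Set.Icc 0 T, HasDerivWithinAt f (f' t) (Set.Icc 0 T) t) (h0 : ‖f 0‖ ≤ δ)
    (hb : ∀ t ∈ Set.Icc 0 T, ‖f' t‖ ≤ K * ‖f t‖ + ε) :
    ∀ t ∈ Set.Icc 0 T, ‖f t‖ ≤ gronwallBound δ K ε t := by
  intro t ht
  have := norm_le_gronwallBound_of_norm_deriv_right_le (f := f) (f' := f') (a := 0) (b := T)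
    (δ := δ) (K := K) (ε := ε) (fun t ht => (hf t ht).continuousWithinAt)
    (fun t ht => (hf t ⟨ht.1, ht.2.le⟩).mono_of_mem_nhdsWithin (Icc_mem_nhdsGE_of_mem ht)) h0
    (fun t ht => hb t ⟨ht.1, ht.2.le⟩) t ht
  simpa using this

theorem eq_zero_of_norm_deriv_le {E : Type*} [NormedAddCommGroup E] [NormedSpace ℝ E]
    {f f' : ℝ → E} {K T : ℝ}
    (hf : ∀ t ∈ Set.Icc 0 T, HasDerivWithinAt f (f' t) (Set.Icc 0 T) t) (h0 : f 0 = 0)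
    (hb : ∀ t ∈ Set.Icc 0 T, ‖f' t‖ ≤ K * ‖f t‖) : ∀ t ∈ Set.Icc 0 T, f t = 0 := by
  intro t ht
  have := norm_le_gronwallBound_Icc (δ := 0) (ε := 0) hf (by simp [h0])
    (fun t ht => by simpa using hb t ht) t ht
  simpa [gronwallBound_ε0] using this

/-! ### Cubic equations as differential equations in `ℓ¹`: uniqueness and propagation of supports.
-/

namespace EllOne

/-- A path in `ℓ¹` whose coefficients have derivatives forming a continuous path in `ℓ¹` is
differentiable in `ℓ¹`. -/
theorem hasDerivWithinAt_of_apply {T : ℝ} {f g : ℝ → EllOne} (hg : ContinuousOn g (Set.Icc 0 T))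
    (h : ∀ t ∈ Set.Icc 0 T, ∀ n, HasDerivWithinAt (fun s => f s n) (g t n) (Set.Icc 0 T) t) :
    ∀ t ∈ Set.Icc 0 T, HasDerivWithinAt f (g t) (Set.Icc 0 T) t := by
  intro t ht
  have hT : 0 ≤ T := ht.1.trans ht.2
  -- Extending `g` continuously to the line gives its integral `I` a two-sided derivative
  -- everywhere; each coefficient of `f - I` is then constant on `[0, T]`.
  set G : ℝ → EllOne := Set.IccExtend hT (fun s : Set.Icc 0 T => g s) with hG
  have hGc : Continuous G := (continuousOn_iff_continuous_domRestrict.1 hg).Icc_extend'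
  have hGg : ∀ s ∈ Set.Icc 0 T, G s = g s := fun s hs => Set.IccExtend_of_mem hT _ hs
  set I : ℝ → EllOne := fun u => ∫ s in (0 : ℝ)..u, G s with hI
  have hId : ∀ s, HasDerivAt I (G s) s := fun s =>
    (hGc.integral_hasStrictDerivAt 0 s).hasDerivAt
  have key : ∀ s ∈ Set.Icc 0 T, f s = f 0 + I s := by
    intro s hs
    refine ext_apply fun n => ?_
    have hd : ∀ u ∈ Set.Icc 0 T,
        HasDerivWithinAt (fun s => f s n - I s n) 0 (Set.Icc 0 T) u := by
      intro u hu
      have h1 : HasDerivAt (fun s => I s n) (G u n) u :=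
        ((lp.evalCLM ℂ (fun _ : Freq => ℂ) 1 n).restrictScalars ℝ).hasFDerivAt.comp_hasDerivAt
          u (hId u)
      have := (h u hu n).sub h1.hasDerivWithinAt
      rwa [hGg u hu, sub_self] at this
    have h0 : I 0 = 0 := by simp [hI]
    have := constant_of_has_deriv_right_zero (fun u hu => (hd u hu).continuousWithinAt)
      (fun u hu => (hd u ⟨hu.1, hu.2.le⟩).mono_of_mem_nhdsWithin (Icc_mem_nhdsGE_of_mem hu)) s hs
    simp only [h0, zero_apply, sub_zero] at this
    rw [add_apply, ← this]
    ring
  have h1 : HasDerivWithinAt (fun s => f 0 + I s) (g t) (Set.Icc 0 T) t := by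
    rw [← hGg t ht]
    exact ((hId t).const_add _).hasDerivWithinAt
  exact h1.congr key (key t ht)

/-- `c` solves `c' = i Q(c, c, c)` in `ℓ¹` on `[0, T]`, where `Q` has the symbol `φ`. -/
def SolvesCubic (φ : ℝ → Freq × Freq × Freq → ℂ) (T : ℝ) (c : ℝ → EllOne) : Prop :=
  ∀ t ∈ Set.Icc 0 T, HasDerivWithinAt c (Complex.I • trilin (φ t) (c t) (c t) (c t))
    (Set.Icc 0 T) t

theorem SolvesCubic.continuousOn {φ : ℝ → Freq × Freq × Freq → ℂ} {T : ℝ} {c : ℝ → EllOne}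
    (h : SolvesCubic φ T c) : ContinuousOn c (Set.Icc 0 T) :=
  fun t ht => (h t ht).continuousWithinAt

theorem exists_pos_bound {T : ℝ} {c : ℝ → EllOne} (h : ContinuousOn c (Set.Icc 0 T)) :
    ∃ M, 0 < M ∧ ∀ t ∈ Set.Icc 0 T, ‖c t‖ ≤ M := by
  obtain ⟨M, hM⟩ := isCompact_Icc.exists_bound_of_continuousOn h
  exact ⟨max M 1, by positivity, fun t ht => (hM t ht).trans (le_max_left _ _)⟩

theorem norm_trilin_cube_sub_le {φ : Freq × Freq × Freq → ℂ} {C M : ℝ} (h : SymbolBound φ C)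
    {x y : EllOne} (hx : ‖x‖ ≤ M) (hy : ‖y‖ ≤ M) :
    ‖trilin φ x x x - trilin φ y y y‖ ≤ 3 * C * M ^ 2 * ‖x - y‖ := by
  have hC := h.nonneg
  have hM : 0 ≤ M := (norm_nonneg _).trans hx
  refine (norm_trilin_sub_trilin_le h _ _ _ _ _ _).trans ?_
  have h1 : ‖x - y‖ * (‖x‖ * ‖x‖) ≤ ‖x - y‖ * (M * M) := by gcongr
  have h2 : ‖y‖ * (‖x - y‖ * ‖x‖) ≤ M * (‖x - y‖ * M) := by gcongr
  have h3 : ‖y‖ * (‖y‖ * ‖x - y‖) ≤ M * (M * ‖x - y‖) := by gcongr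
  nlinarith

theorem SolvesCubic.unique {φ : ℝ → Freq × Freq × Freq → ℂ} {T : ℝ} {c d : ℝ → EllOne}
    (hφ : ∀ t, SymbolBound (φ t) 1) (hc : SolvesCubic φ T c) (hd : SolvesCubic φ T d)
    (h0 : c 0 = d 0) : ∀ t ∈ Set.Icc 0 T, c t = d t := by
  intro t ht
  obtain ⟨M, hM, hcM⟩ := exists_pos_bound hc.continuousOn
  obtain ⟨M', hM', hdM⟩ := exists_pos_bound hd.continuousOn
  refine sub_eq_zero.1 (eq_zero_of_norm_deriv_le (f := fun t => c t - d t)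
    (K := 3 * 1 * (max M M') ^ 2) (fun t ht => (hc t ht).sub (hd t ht)) (sub_eq_zero.2 h0)
    (fun t ht => ?_) t ht)
  rw [← smul_sub, norm_smul, Complex.norm_I, one_mul]
  exact norm_trilin_cube_sub_le (hφ t) ((hcM t ht).trans (le_max_left _ _))
    ((hdM t ht).trans (le_max_right _ _))

/-- Inputs in `S` produce no output outside `S`, so the output there is unchanged by subtracting the
cube of the part of `c` in `S`. It is therefore Lipschitz in the part of `c` outside `S`, which
starts at zero, and Gronwall applies. -/
theorem SolvesCubic.supportedIn {φ : ℝ → Freq × Freq × Freq → ℂ} {T : ℝ} {c : ℝ → EllOne}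
    (hφ : ∀ t, SymbolBound (φ t) 1) (hc : SolvesCubic φ T c) {S : Set Freq}
    (hS : ∀ t k, k.1 ∈ S → k.2.1 ∈ S → k.2.2 ∈ S → outFreq k ∉ S → φ t k = 0)
    (h0 : SupportedIn S (c 0)) : ∀ t ∈ Set.Icc 0 T, SupportedIn S (c t) := by
  intro t ht n hn
  obtain ⟨M, hM, hcM⟩ := exists_pos_bound hc.continuousOn
  have h := eq_zero_of_norm_deriv_le (f := fun t => restrict Sᶜ (c t))
    (f' := fun t => restrict Sᶜ (Complex.I • trilin (φ t) (c t) (c t) (c t)))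
    (K := 3 * 1 * M ^ 2)
    (fun t ht => ((restrict Sᶜ).restrictScalars ℝ).hasFDerivAt.comp_hasDerivWithinAt t (hc t ht))
    (ext_apply fun n => ?_) (fun t ht => ?_) t ht
  · rw [← restrict_of_mem (S := Sᶜ) hn (c t), h, zero_apply]
  · by_cases hn : n ∈ S
    · rw [restrict_of_notMem (S := Sᶜ) (not_not.2 hn), zero_apply]
    · rw [restrict_of_mem (S := Sᶜ) hn, h0 n hn, zero_apply]
  · rw [map_smul, norm_smul, Complex.norm_I, one_mul]
    have hz : restrict Sᶜ (trilin (φ t) (restrict S (c t)) (restrict S (c t))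
        (restrict S (c t))) = 0 := by
      refine ext_apply fun n => ?_
      by_cases hn : n ∈ S
      · rw [restrict_of_notMem (S := Sᶜ) (not_not.2 hn), zero_apply]
      · rw [restrict_of_mem (S := Sᶜ) hn, zero_apply]
        exact supportedIn_trilin (hφ t) (supportedIn_restrict _ _) (supportedIn_restrict _ _)
          (supportedIn_restrict _ _) (hS t) n hn
    rw [← sub_zero (restrict Sᶜ (trilin (φ t) (c t) (c t) (c t))), ← hz, ← map_sub]
    refine (norm_restrict_le _ _).trans ((norm_trilin_cube_sub_le (hφ t) (hcM t ht)
      ((norm_restrict_le _ _).trans (hcM t ht))).trans (le_of_eq ?_))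
    congr 2
    rw [sub_eq_iff_eq_add', restrict_add_restrict_compl]

end EllOne

/-! ### Radial truncation and global existence. -/

/-- The radial retraction of a normed space onto the ball of radius `R`. -/
noncomputable def radialRetraction {E : Type*} [NormedAddCommGroup E] [NormedSpace ℝ E] (R : ℝ)
    (x : E) : E := (R / max R ‖x‖) • x

section radial

variable {E : Type*} [NormedAddCommGroup E] [NormedSpace ℝ E] {R : ℝ}

theorem radialRetraction_of_norm_le (hR : 0 < R) {x : E} (hx : ‖x‖ ≤ R) :
    radialRetraction R x = x := by
  rw [radialRetraction, max_eq_left hx, div_self hR.ne', one_smul]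

theorem norm_radialRetraction_le (hR : 0 < R) (x : E) : ‖radialRetraction R x‖ ≤ R := by
  have hm : 0 < max R ‖x‖ := lt_max_of_lt_left hR
  rw [radialRetraction, norm_smul, Real.norm_of_nonneg (by positivity), div_mul_eq_mul_div,
    div_le_iff₀ hm]
  exact mul_le_mul_of_nonneg_left (le_max_right _ _) hR.le

/-- One copy of `‖x - y‖` comes from moving the point at a fixed scaling factor, the other from the
change of that factor. -/
theorem norm_radialRetraction_sub_le (hR : 0 < R) (x y : E) :
    ‖radialRetraction R x - radialRetraction R y‖ ≤ 2 * ‖x - y‖ := by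
  have hm : 0 < max R ‖x‖ := lt_max_of_lt_left hR
  have hm' : 0 < max R ‖y‖ := lt_max_of_lt_left hR
  have h1 : radialRetraction R x - radialRetraction R y =
      (R / max R ‖x‖) • (x - y) + (R / max R ‖x‖ - R / max R ‖y‖) • y := by
    simp only [radialRetraction, smul_sub, sub_smul]
    abel
  have h2 : ‖(R / max R ‖x‖) • (x - y)‖ ≤ ‖x - y‖ := by
    rw [norm_smul, Real.norm_of_nonneg (by positivity)]
    exact mul_le_of_le_one_left (norm_nonneg _) ((div_le_one hm).2 (le_max_left _ _))
  have h3 : ‖(R / max R ‖x‖ - R / max R ‖y‖) • y‖ ≤ ‖x - y‖ := by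
    have habs : |max R ‖x‖ - max R ‖y‖| ≤ ‖x - y‖ := by
      have := abs_max_sub_max_le_abs ‖x‖ ‖y‖ R
      rw [max_comm R, max_comm R]
      exact this.trans (abs_norm_sub_norm_le x y)
    have he : R / max R ‖x‖ - R / max R ‖y‖ =
        R / max R ‖x‖ * ((max R ‖y‖ - max R ‖x‖) / max R ‖y‖) := by
      field_simp
    rw [norm_smul, he, norm_mul, Real.norm_of_nonneg (r := R / max R ‖x‖) (by positivity),
      norm_div, Real.norm_of_nonneg hm'.le, Real.norm_eq_abs, abs_sub_comm]
    have e1 : R / max R ‖x‖ ≤ 1 := (div_le_one hm).2 (le_max_left _ _)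
    have e2 : ‖y‖ / max R ‖y‖ ≤ 1 := (div_le_one hm').2 (le_max_right _ _)
    calc R / max R ‖x‖ * (|max R ‖x‖ - max R ‖y‖| / max R ‖y‖) * ‖y‖
        = (R / max R ‖x‖) * (‖y‖ / max R ‖y‖) * |max R ‖x‖ - max R ‖y‖| := by ring
      _ ≤ 1 * 1 * ‖x - y‖ := by gcongr
      _ = ‖x - y‖ := by ring
  rw [h1]
  exact (norm_add_le _ _).trans (by linarith)

end radial

namespace EllOne

/-- Global existence for the cubic equation whose nonlinearity is cut off radially. -/
theorem exists_solution_radial {φ : ℝ → Freq × Freq × Freq → ℂ} {T R : ℝ} (hT : 0 ≤ T)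
    (hR : 0 < R) (hφ : ∀ t, SymbolBound (φ t) 1) (hc : ∀ k, Continuous fun t => φ t k)
    (x₀ : EllOne) : ∃ c : ℝ → EllOne, c 0 = x₀ ∧ ∀ t ∈ Set.Icc 0 T,
      HasDerivWithinAt c (Complex.I • trilin (φ t) (radialRetraction R (c t))
        (radialRetraction R (c t)) (radialRetraction R (c t))) (Set.Icc 0 T) t := by
  have hpl : IsPicardLindelof (E := EllOne)
      (fun t x => Complex.I • trilin (φ t) (radialRetraction R x)
        (radialRetraction R x) (radialRetraction R x)) (tmin := 0) (tmax := T)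
      -- The truncated field is bounded by `R³`, so over time `T` a solution cannot leave the ball
      -- of radius `R³T`; hence a single Picard–Lindelöf step covers `[0, T]`.
      ⟨0, ⟨le_rfl, hT⟩⟩ x₀ (Real.toNNReal (R ^ 3 * T)) 0 (Real.toNNReal (R ^ 3))
      (Real.toNNReal (3 * 1 * R ^ 2 * 2)) := by
    refine ⟨fun t ht => ?_, fun x _ => ?_, fun t ht x _ => ?_, ?_⟩
    · refine (LipschitzWith.of_dist_le_mul fun x y => ?_).lipschitzOnWith
      rw [dist_eq_norm, dist_eq_norm, ← smul_sub, norm_smul, Complex.norm_I, one_mul,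
        Real.coe_toNNReal _ (by positivity)]
      refine (norm_trilin_cube_sub_le (hφ t) (norm_radialRetraction_le hR x)
        (norm_radialRetraction_le hR y)).trans ?_
      rw [mul_assoc (3 * 1 * R ^ 2)]
      exact mul_le_mul_of_nonneg_left (norm_radialRetraction_sub_le hR x y) (by positivity)
    · exact (continuousOn_trilin hφ hc continuousOn_const continuousOn_const
        continuousOn_const).const_smul Complex.I
    · rw [norm_smul, Complex.norm_I, one_mul, Real.coe_toNNReal _ (by positivity)]
      refine (norm_trilin_le (hφ t) _ _ _).trans ?_
      have := norm_radialRetraction_le hR x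
      calc 1 * (‖radialRetraction R x‖ * (‖radialRetraction R x‖ * ‖radialRetraction R x‖))
          ≤ 1 * (R * (R * R)) := by gcongr
        _ = R ^ 3 := by ring
    · simp only [sub_zero, NNReal.coe_zero, sub_self]
      rw [max_eq_left hT, Real.coe_toNNReal _ (by positivity), Real.coe_toNNReal _ (by positivity)]
  obtain ⟨c, hc0, hc⟩ := hpl.exists_eq_forall_mem_Icc_hasDerivWithinAt₀
  exact ⟨c, hc0, hc⟩

end EllOne

/-! ### The two systems as cubic equations with explicit symbols. -/

/-- The resonance factor of the interaction `k`, whose output is `outFreq k`. -/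
def resonance (k : Freq × Freq × Freq) : ℤ := omegaFour (outFreq k) k

/-- The coefficient of the interaction `k` in the nonlinearity of the equation. -/
def interactionSign (k : Freq × Freq × Freq) : ℂ :=
  if k.1 = k.2.1 ∧ k.2.1 = k.2.2 then -1 else if k.1 ≠ k.2.1 ∧ k.2.1 ≠ k.2.2 then 1 else 0

/-- The oscillating factor `exp(iω₄t)` of the interaction `k`. -/
noncomputable def phase (t : ℝ) (k : Freq × Freq × Freq) : ℂ :=
  Complex.exp (Complex.I * ((resonance k : ℤ) : ℂ) * (t : ℂ))

/-- The symbol of the system `FNLS`. -/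
noncomputable def fnlsSymbol (t : ℝ) (k : Freq × Freq × Freq) : ℂ := interactionSign k * phase t k

/-- The symbol of the system `RFNLS`. -/
def rfnlsSymbol (k : Freq × Freq × Freq) : ℂ := interactionSign k * if resonance k = 0 then 1 else 0

theorem norm_interactionSign_le (k : Freq × Freq × Freq) : ‖interactionSign k‖ ≤ 1 := by
  unfold interactionSign
  split_ifs <;> simp

theorem norm_phase (t : ℝ) (k : Freq × Freq × Freq) : ‖phase t k‖ = 1 := by
  rw [phase, Complex.norm_exp]
  simp

theorem symbolBound_fnls (t : ℝ) : EllOne.SymbolBound (fnlsSymbol t) 1 := fun k => by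
  rw [fnlsSymbol, norm_mul, norm_phase, mul_one]
  exact norm_interactionSign_le k

theorem symbolBound_rfnls : EllOne.SymbolBound rfnlsSymbol 1 := fun k => by
  rw [rfnlsSymbol, norm_mul]
  have : ‖(if resonance k = 0 then 1 else 0 : ℂ)‖ ≤ 1 := by split_ifs <;> simp
  exact mul_le_one₀ (norm_interactionSign_le k) (norm_nonneg _) this

theorem hasDerivAt_phase (k : Freq × Freq × Freq) (t : ℝ) :
    HasDerivAt (fun t => phase t k) (Complex.I * resonance k * phase t k) t := by
  have h1 : HasDerivAt (fun t : ℝ => Complex.I * ((resonance k : ℤ) : ℂ) * (t : ℂ))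
      (Complex.I * ((resonance k : ℤ) : ℂ)) t := by
    simpa using (Complex.ofRealCLM.hasDerivAt (x := t)).const_mul
      (Complex.I * ((resonance k : ℤ) : ℂ))
  simpa [phase, mul_comm] using h1.cexp

theorem continuous_fnlsSymbol (k : Freq × Freq × Freq) : Continuous fun t => fnlsSymbol t k :=
  continuous_const.mul
    (continuous_iff_continuousAt.2 fun t => (hasDerivAt_phase k t).continuousAt)

/-- Given `n₁ - n₂ + n₃ = n`, the exclusion `n₁ ≠ n` says `n₂ ≠ n₃`, and `n₃ ≠ n` says `n₁ ≠ n₂`. In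
this form the exclusions involve the triple alone, as a symbol requires. -/
theorem mem_nlsGamma_iff {n : Freq} {k : Freq × Freq × Freq} :
    k ∈ nlsGamma n ↔ outFreq k = n ∧ k.1 ≠ k.2.1 ∧ k.2.1 ≠ k.2.2 := by
  obtain ⟨a, b, c⟩ := k
  simp only [nlsGamma, outFreq, Set.mem_ofPred_eq]
  constructor
  · rintro ⟨h, h1, h2⟩
    refine ⟨h, fun e => h2 ?_, fun e => h1 ?_⟩
    · rw [← h, e]; abel
    · rw [← h, e]; abel
  · rintro ⟨h, h1, h2⟩
    refine ⟨h, fun e => h2 ?_, fun e => h1 ?_⟩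
    · linear_combination e - h
    · linear_combination h - e

theorem outFreq_diag (n : Freq) : outFreq (n, n, n) = n := by simp [outFreq]

theorem resonance_diag (n : Freq) : resonance (n, n, n) = 0 := by
  simp [resonance, omegaFour, outFreq_diag]

theorem interactionSign_diag (n : Freq) : interactionSign (n, n, n) = -1 := by
  simp [interactionSign]

namespace EllOne

/-- The triple `(n, n, n)` lies outside `Γ(n)` and carries the sign `-1`, which reproduces the
self-interaction term; the other triples with output `n` outside `Γ(n)` have coefficient zero. -/
theorem trilin_interaction_apply {ψ : Freq × Freq × Freq → ℂ} (hψ : SymbolBound ψ 1)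
    (hdiag : ∀ n, ψ (n, n, n) = 1) (x : EllOne) (n : Freq) :
    trilin (fun k => interactionSign k * ψ k) x x x n = -(x n * (‖x n‖ : ℂ) ^ 2) +
      ∑' k : nlsGamma n, x k.1.1 * starRingEnd ℂ (x k.1.2.1) * x k.1.2.2 * ψ k.1 := by
  have hb : SymbolBound (fun k => interactionSign k * ψ k) 1 := fun k => by
    rw [norm_mul]
    exact mul_le_one₀ (norm_interactionSign_le k) (norm_nonneg _) (hψ k)
  set g : Freq × Freq × Freq → ℂ :=
    fun k => x k.1 * starRingEnd ℂ (x k.2.1) * x k.2.2 * ψ k with hg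
  have hs : Summable ((nlsGamma n).indicator g) := by
    refine Summable.of_norm_bounded (summable_triple x x x) fun k => ?_
    refine (norm_indicator_le_norm_self g k).trans ?_
    simp only [hg, norm_mul, RCLike.norm_conj]
    calc ‖x k.1‖ * ‖x k.2.1‖ * ‖x k.2.2‖ * ‖ψ k‖
        ≤ ‖x k.1‖ * ‖x k.2.1‖ * ‖x k.2.2‖ * 1 := by gcongr; exact hψ k
      _ = _ := by ring
  have hd : HasSum (fun k : Freq × Freq × Freq =>
      if k = (n, n, n) then -(x n * (‖x n‖ : ℂ) ^ 2) else 0) (-(x n * (‖x n‖ : ℂ) ^ 2)) :=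
    hasSum_ite_eq _ _
  rw [trilin_apply hb, tsum_subtype (nlsGamma n) g]
  refine (tsum_congr fun k => ?_).trans (hd.add hs.hasSum).tsum_eq
  by_cases hk : outFreq k = n
  · rw [if_pos hk]
    by_cases h1 : k = (n, n, n)
    · subst h1
      rw [Set.indicator_of_notMem (by rw [mem_nlsGamma_iff]; simp), if_pos rfl,
        interactionSign_diag, hdiag, ← Complex.mul_conj']
      ring
    · rw [if_neg h1]
      by_cases h2 : k.1 ≠ k.2.1 ∧ k.2.1 ≠ k.2.2
      · rw [Set.indicator_of_mem (mem_nlsGamma_iff.2 ⟨hk, h2⟩), interactionSign,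
          if_neg (fun h => h2.1 h.1), if_pos h2, hg]
        ring
      · rw [Set.indicator_of_notMem (fun h => h2 (mem_nlsGamma_iff.1 h).2), interactionSign,
          if_neg, if_neg h2]
        · ring
        · rintro ⟨e1, e2⟩
          obtain ⟨a, b, c⟩ := k
          simp only at e1 e2
          subst e1 e2
          rw [outFreq_diag] at hk
          exact h1 (by rw [hk])
  · rw [if_neg hk, if_neg fun h => hk (by rw [h, outFreq_diag]),
      Set.indicator_of_notMem (fun h => hk (mem_nlsGamma_iff.1 h).1), add_zero]

theorem trilin_fnlsSymbol_apply (t : ℝ) (x : EllOne) (n : Freq) :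
    trilin (fnlsSymbol t) x x x n = fnlsRHS t x n := by
  rw [fnlsRHS]
  refine (trilin_interaction_apply (ψ := phase t) (fun k => (norm_phase t k).le)
    (fun n => by simp [phase, resonance_diag]) x n).trans ?_
  congr 1
  refine tsum_congr fun k => ?_
  rw [phase, resonance, (mem_nlsGamma_iff.1 k.2).1]

theorem trilin_rfnlsSymbol_apply (x : EllOne) (n : Freq) :
    trilin rfnlsSymbol x x x n = rfnlsRHS x n := by
  rw [rfnlsRHS]
  refine (trilin_interaction_apply (ψ := fun k => if resonance k = 0 then 1 else 0)
    (fun k => by simp only []; split_ifs <;> simp) (fun n => by simp [resonance_diag]) x n).trans ?_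
  congr 1
  rw [tsum_subtype (nlsGamma n) (fun k : Freq × Freq × Freq =>
      x k.1 * starRingEnd ℂ (x k.2.1) * x k.2.2 * if resonance k = 0 then 1 else 0),
    tsum_subtype (nlsGammaRes n) (fun k : Freq × Freq × Freq =>
      x k.1 * starRingEnd ℂ (x k.2.1) * x k.2.2)]
  refine tsum_congr fun k => ?_
  by_cases hk : k ∈ nlsGamma n
  · have hr : resonance k = omegaFour n k := by rw [resonance, (mem_nlsGamma_iff.1 hk).1]
    by_cases h0 : omegaFour n k = 0
    · rw [Set.indicator_of_mem hk, Set.indicator_of_mem (s := nlsGammaRes n) ⟨hk, h0⟩, hr,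
        if_pos h0, mul_one]
    · rw [Set.indicator_of_mem hk,
        Set.indicator_of_notMem (s := nlsGammaRes n) (fun h => h0 h.2), hr, if_neg h0, mul_zero]
  · rw [Set.indicator_of_notMem hk,
      Set.indicator_of_notMem (s := nlsGammaRes n) (fun h => hk h.1)]

theorem solvesFNLS_iff {T : ℝ} {c : ℝ → EllOne} :
    SolvesFNLS T c ↔ SolvesCubic fnlsSymbol T c := by
  constructor
  · rintro ⟨hc, hd⟩
    refine hasDerivWithinAt_of_apply
      ((continuousOn_trilin symbolBound_fnls continuous_fnlsSymbol hc hc hc).const_smul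
        Complex.I) fun t ht n => ?_
    rw [smul_apply, trilin_fnlsSymbol_apply]
    exact hd t ht n
  · intro h
    refine ⟨h.continuousOn, fun t ht n => ?_⟩
    rw [← trilin_fnlsSymbol_apply, ← smul_apply]
    exact ((lp.evalCLM ℂ (fun _ : Freq => ℂ) 1 n).restrictScalars
      ℝ).hasFDerivAt.comp_hasDerivWithinAt t (h t ht)

theorem solvesCubic_of_solvesRFNLS {T : ℝ} {c : ℝ → EllOne} (h : SolvesRFNLS T c) :
    SolvesCubic (fun _ => rfnlsSymbol) T c := by
  have hc := h.continuousOn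
  refine hasDerivWithinAt_of_apply
    ((continuousOn_trilin (fun _ => symbolBound_rfnls) (fun _ => continuous_const)
      hc hc hc).const_smul Complex.I) fun t ht n => ?_
  rw [smul_apply, trilin_rfnlsSymbol_apply]
  exact h.hasDeriv t ht n

end EllOne

/-! ### Conservation of mass. -/

namespace EllOne

/-- The symbol for which the zeroth coefficient of `trilin` is the `ℓ²` scalar product. -/
def pairingSymbol (k : Freq × Freq × Freq) : ℂ := if k.1 = k.2.1 ∧ k.2.2 = 0 then 1 else 0

theorem symbolBound_pairing : SymbolBound pairingSymbol 1 := fun k => by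
  unfold pairingSymbol
  split_ifs <;> simp

/-- The pairing `∑ xₙ conj yₙ`, which exists in `ℓ¹`. -/
noncomputable def pairing (x y : EllOne) : ℂ :=
  trilin pairingSymbol x y (lp.single 1 0 1) 0

theorem pairing_eq_tsum (x y : EllOne) : pairing x y = ∑' n, x n * starRingEnd ℂ (y n) := by
  rw [pairing, trilin_apply symbolBound_pairing]
  have hinj : Function.Injective fun n : Freq => ((n, n, 0) : Freq × Freq × Freq) :=
    fun a b h => congrArg Prod.fst h
  rw [← hinj.tsum_eq]
  · refine tsum_congr fun n => ?_
    simp [outFreq, pairingSymbol]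
  · intro k hk
    obtain ⟨a, b, c⟩ := k
    by_cases h : a = b ∧ c = 0
    · exact ⟨a, by simp [h.1, h.2]⟩
    · exact absurd (by simp [pairingSymbol, h]) hk

theorem norm_pairing_le (x y : EllOne) : ‖pairing x y‖ ≤ ‖x‖ * ‖y‖ := by
  refine (norm_apply_le _ _).trans ((norm_trilin_le symbolBound_pairing _ _ _).trans ?_)
  simp [lp.norm_single]

theorem conj_pairing (x y : EllOne) : starRingEnd ℂ (pairing x y) = pairing y x := by
  rw [pairing_eq_tsum, pairing_eq_tsum, Complex.conj_tsum]
  exact tsum_congr fun n => by simp [mul_comm]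

/-- The pairing as a function of its first argument. -/
noncomputable def pairingCLM (y : EllOne) : EllOne →L[ℂ] ℂ :=
  LinearMap.mkContinuous
    { toFun := fun x => pairing x y
      map_add' := fun x x' => by
        rw [pairing, trilin_add_left symbolBound_pairing]; rfl
      map_smul' := fun a x => by
        rw [pairing, trilin_smul_left symbolBound_pairing]; rfl } ‖y‖ fun x => by
    rw [mul_comm]
    exact norm_pairing_le x y

theorem pairingCLM_apply (x y : EllOne) : pairingCLM y x = pairing x y := rfl

theorem pairing_trilinTerm (φ : Freq × Freq × Freq → ℂ) (x y z w : EllOne)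
    (k : Freq × Freq × Freq) : pairing (trilinTerm φ x y z k) w =
      φ k * (x k.1 * starRingEnd ℂ (y k.2.1) * z k.2.2) * starRingEnd ℂ (w (outFreq k)) := by
  rw [pairing_eq_tsum, tsum_eq_single (outFreq k)]
  · simp [trilinTerm]
  · intro n hn
    rw [trilinTerm, lp.single_apply_ne _ _ _ hn, zero_mul]

/-- The involution exchanging the roles of the first input and the output of an interaction. -/
def swapInteraction : Freq × Freq × Freq ≃ Freq × Freq × Freq :=
  Function.Involutive.toPerm (fun k => (outFreq k, k.2.2, k.2.1)) fun k => by
    obtain ⟨a, b, c⟩ := k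
    simp [outFreq]

theorem swapInteraction_apply (k : Freq × Freq × Freq) :
    swapInteraction k = (outFreq k, k.2.2, k.2.1) := rfl

theorem outFreq_swapInteraction (k : Freq × Freq × Freq) : outFreq (swapInteraction k) = k.1 := by
  simp [swapInteraction_apply, outFreq]

theorem resonance_swapInteraction (k : Freq × Freq × Freq) :
    resonance (swapInteraction k) = -resonance k := by
  rw [resonance, outFreq_swapInteraction, resonance, swapInteraction_apply]
  simp only [omegaFour]
  ring

theorem interactionSign_swapInteraction (k : Freq × Freq × Freq) :
    interactionSign (swapInteraction k) = interactionSign k := by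
  obtain ⟨a, b, c⟩ := k
  have h1 : a - b + c = c ↔ a = b := by
    rw [add_eq_right, sub_eq_zero]
  simp only [interactionSign, swapInteraction_apply, outFreq, ne_eq, h1, eq_comm (a := c)]

theorem conj_interactionSign (k : Freq × Freq × Freq) :
    starRingEnd ℂ (interactionSign k) = interactionSign k := by
  unfold interactionSign
  split_ifs <;> simp

theorem conj_phase (t : ℝ) (k : Freq × Freq × Freq) :
    starRingEnd ℂ (phase t k) = phase t (swapInteraction k) := by
  rw [phase, phase, ← Complex.exp_conj, resonance_swapInteraction]
  simp

/-- Exchanging `n₁` with the output and `n₂` with `n₃` preserves the coefficient and reverses `ω₄`,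
so it sends each term of the sum to its conjugate. -/
theorem conj_pairing_fnls (t : ℝ) (x : EllOne) :
    starRingEnd ℂ (pairing (trilin (fnlsSymbol t) x x x) x) =
      pairing (trilin (fnlsSymbol t) x x x) x := by
  have h : pairing (trilin (fnlsSymbol t) x x x) x = ∑' k, fnlsSymbol t k *
      (x k.1 * starRingEnd ℂ (x k.2.1) * x k.2.2) * starRingEnd ℂ (x (outFreq k)) := by
    rw [← pairingCLM_apply, trilin,
      (pairingCLM x).map_tsum (summable_trilinTerm (symbolBound_fnls t) x x x)]
    exact tsum_congr fun k => pairing_trilinTerm _ _ _ _ _ _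
  rw [h, Complex.conj_tsum]
  conv_rhs => rw [← swapInteraction.tsum_eq]
  refine tsum_congr fun k => ?_
  rw [fnlsSymbol, fnlsSymbol, outFreq_swapInteraction, interactionSign_swapInteraction,
    ← conj_phase]
  simp only [swapInteraction_apply, map_mul, conj_interactionSign, Complex.conj_conj]
  ring

/-- The derivative is `i` times the pairing of the nonlinearity with `c`, plus the conjugate; it
vanishes because that pairing is real. -/
theorem SolvesCubic.pairing_self {T : ℝ} {c : ℝ → EllOne} (h : SolvesCubic fnlsSymbol T c) :
    ∀ t ∈ Set.Icc 0 T, pairing (c t) (c t) = pairing (c 0) (c 0) := by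
  intro t ht
  refine sub_eq_zero.1 (eq_zero_of_norm_deriv_le (K := 0)
    (f := fun t => pairing (c t) (c t) - pairing (c 0) (c 0)) (f' := fun _ => 0)
    (fun t ht => ?_) (sub_self _) (by simp) t ht)
  have hd := hasDerivWithinAt_trilin (φ := fun _ => pairingSymbol) (φ' := fun _ _ => 0) (D := 0)
    (fun _ => symbolBound_pairing) (fun _ k => by simp) (fun k t => hasDerivAt_const _ _)
    (h t ht) (h t ht) (hasDerivWithinAt_const t (Set.Icc 0 T) (lp.single 1 (0 : Freq) (1 : ℂ)))
  have he := ((lp.evalCLM ℂ (fun _ : Freq => ℂ) 1 0).restrictScalars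
    ℝ).hasFDerivAt.comp_hasDerivWithinAt t hd
  refine (he.sub_const (pairing (c 0) (c 0))).congr_deriv ?_
  have h0 : trilin (fun _ => 0) (c t) (c t) (lp.single 1 (0 : Freq) (1 : ℂ)) = 0 :=
    trilin_eq_zero fun _ _ _ _ => rfl
  have h1 : trilin pairingSymbol (c t) (c t) (0 : EllOne) = 0 :=
    trilin_eq_zero fun k _ _ hk => absurd rfl hk
  rw [h0, h1, zero_add, add_zero, trilin_smul_left symbolBound_pairing,
    trilin_smul_mid symbolBound_pairing]
  set X := trilin (fnlsSymbol t) (c t) (c t) (c t)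
  have hp : pairing X (c t) = pairing (c t) X := by
    rw [← conj_pairing X, conj_pairing_fnls]
  change Complex.I * pairing X (c t) + starRingEnd ℂ Complex.I * pairing (c t) X = 0
  rw [hp, Complex.conj_I]
  ring

theorem pairing_self_eq (x : EllOne) : pairing x x =
    (‖x 0‖ : ℂ) ^ 2 + pairing (restrict {0}ᶜ x) (restrict {0}ᶜ x) := by
  have h1 : pairing (restrict {0} x) (restrict {0} x) = (‖x 0‖ : ℂ) ^ 2 := by
    rw [pairing_eq_tsum, tsum_eq_single 0, restrict_of_mem (Set.mem_singleton 0), Complex.mul_conj']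
    intro n hn
    rw [restrict_of_notMem (S := {0}) hn, zero_mul]
  have h2 : pairing (restrict {0} x) (restrict {0}ᶜ x) = 0 := by
    rw [pairing_eq_tsum]
    refine (tsum_congr fun n => ?_).trans tsum_zero
    by_cases hn : n ∈ ({0} : Set Freq)
    · rw [restrict_of_notMem (S := {0}ᶜ) (not_not.2 hn), map_zero, mul_zero]
    · rw [restrict_of_notMem hn, zero_mul]
  have h3 : pairing (restrict {0}ᶜ x) (restrict {0} x) = 0 := by
    rw [← conj_pairing, h2, map_zero]
  have hmid : ∀ u v w : EllOne, pairing u (v + w) = pairing u v + pairing u w := fun u v w => by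
    rw [pairing, trilin_add_mid symbolBound_pairing]; rfl
  have hleft : ∀ u v w : EllOne, pairing (u + v) w = pairing u w + pairing v w := fun u v w =>
    map_add (pairingCLM w) u v
  conv_lhs => rw [← restrict_add_restrict_compl {0} x]
  rw [hleft, hmid, hmid, h1, h2, h3]
  ring

/-- Conservation of mass controls the modulus of the zeroth coefficient. -/
theorem SolvesCubic.abs_sq_sub_sq_le {T M : ℝ} {c : ℝ → EllOne}
    (h : SolvesCubic fnlsSymbol T c) (hM : ∀ t ∈ Set.Icc 0 T, ‖restrict {0}ᶜ (c t)‖ ≤ M) :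
    ∀ t ∈ Set.Icc 0 T, |‖c 0 0‖ ^ 2 - ‖c t 0‖ ^ 2| ≤ 2 * M ^ 2 := by
  intro t ht
  have h0 : (0 : ℝ) ∈ Set.Icc 0 T := ⟨le_rfl, ht.1.trans ht.2⟩
  have he := h.pairing_self t ht
  rw [pairing_self_eq, pairing_self_eq (c 0)] at he
  have hn : (((‖c 0 0‖ ^ 2 - ‖c t 0‖ ^ 2 : ℝ)) : ℂ) =
      pairing (restrict {0}ᶜ (c t)) (restrict {0}ᶜ (c t)) -
        pairing (restrict {0}ᶜ (c 0)) (restrict {0}ᶜ (c 0)) := by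
    push_cast
    linear_combination -he
  have hb : ∀ s ∈ Set.Icc 0 T,
      ‖pairing (restrict {0}ᶜ (c s)) (restrict {0}ᶜ (c s))‖ ≤ M ^ 2 := fun s hs => by
    refine (norm_pairing_le _ _).trans ?_
    rw [sq]
    exact mul_self_le_mul_self (norm_nonneg _) (hM s hs)
  rw [← Real.norm_eq_abs, ← Complex.norm_real, hn]
  refine (norm_sub_le _ _).trans ?_
  linarith [hb t ht, hb 0 h0]

end EllOne

/-! ### Averaging out the interactions with one rotating zero mode. -/

namespace EllOne

theorem hasDerivWithinAt_trilin_const {r : Freq × Freq × Freq → ℂ} {C : ℝ} {s : Set ℝ}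
    {t : ℝ} (hr : SymbolBound r C) {x y z : ℝ → EllOne} {x' y' z' : EllOne}
    (hx : HasDerivWithinAt x x' s t) (hy : HasDerivWithinAt y y' s t)
    (hz : HasDerivWithinAt z z' s t) :
    HasDerivWithinAt (fun t => trilin r (x t) (y t) (z t))
      (trilin r x' (y t) (z t) + trilin r (x t) y' (z t) + trilin r (x t) (y t) z') s t := by
  have h := hasDerivWithinAt_trilin (φ := fun _ => r) (φ' := fun _ _ => 0) (D := 0)
    (fun _ => hr) (fun _ k => by simp) (fun k t => hasDerivAt_const _ _) hx hy hz
  rwa [trilin_eq_zero (φ := fun _ => 0) fun _ _ _ _ => rfl, zero_add] at h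

/-- No interaction of `r` between the zero mode and two modes of `Λ`. -/
structure ZeroDecoupled (r : Freq × Freq × Freq → ℂ) (Λ : Set Freq) : Prop where
  left : ∀ a x y, SupportedIn {0} a → SupportedIn Λ x → SupportedIn Λ y → trilin r a x y = 0
  mid : ∀ a x y, SupportedIn {0} a → SupportedIn Λ x → SupportedIn Λ y → trilin r x a y = 0
  right : ∀ a x y, SupportedIn {0} a → SupportedIn Λ x → SupportedIn Λ y → trilin r x y a = 0

section decoupled

variable {r : Freq × Freq × Freq → ℂ} {Λ : Set Freq} {a p p₀ q q₀ : EllOne}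

/-- The expression vanishes at `(p₀, q₀)`, so it is controlled by the deviations of `p` and `q` from
there. This is the form in which Property VIII enters the estimates. -/
theorem ZeroDecoupled.norm_left_le (h : ZeroDecoupled r Λ) (hr : SymbolBound r 1)
    (ha : SupportedIn {0} a) (hp : SupportedIn Λ p₀) (hq : SupportedIn Λ q₀) :
    ‖trilin r a p q‖ ≤ ‖a‖ * (‖p - p₀‖ * ‖q‖ + ‖p₀‖ * ‖q - q₀‖) := by
  have he : trilin r a p q = trilin r a (p - p₀) q + trilin r a p₀ (q - q₀) := by
    rw [trilin_sub_mid hr, trilin_sub_right hr, h.left _ _ _ ha hp hq]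
    abel
  rw [he]
  refine (norm_add_le _ _).trans ((add_le_add (norm_trilin_le hr _ _ _)
    (norm_trilin_le hr _ _ _)).trans (le_of_eq (by ring)))

theorem ZeroDecoupled.norm_mid_le (h : ZeroDecoupled r Λ) (hr : SymbolBound r 1)
    (ha : SupportedIn {0} a) (hp : SupportedIn Λ p₀) (hq : SupportedIn Λ q₀) :
    ‖trilin r p a q‖ ≤ ‖a‖ * (‖p - p₀‖ * ‖q‖ + ‖p₀‖ * ‖q - q₀‖) := by
  have he : trilin r p a q = trilin r (p - p₀) a q + trilin r p₀ a (q - q₀) := by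
    rw [trilin_sub_left hr, trilin_sub_right hr, h.mid _ _ _ ha hp hq]
    abel
  rw [he]
  refine (norm_add_le _ _).trans ((add_le_add (norm_trilin_le hr _ _ _)
    (norm_trilin_le hr _ _ _)).trans (le_of_eq (by ring)))

theorem ZeroDecoupled.norm_right_le (h : ZeroDecoupled r Λ) (hr : SymbolBound r 1)
    (ha : SupportedIn {0} a) (hp : SupportedIn Λ p₀) (hq : SupportedIn Λ q₀) :
    ‖trilin r p q a‖ ≤ ‖a‖ * (‖p - p₀‖ * ‖q‖ + ‖p₀‖ * ‖q - q₀‖) := by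
  have he : trilin r p q a = trilin r (p - p₀) q a + trilin r p₀ (q - q₀) a := by
    rw [trilin_sub_left hr, trilin_sub_mid hr, h.right _ _ _ ha hp hq]
    abel
  rw [he]
  refine (norm_add_le _ _).trans ((add_le_add (norm_trilin_le hr _ _ _)
    (norm_trilin_le hr _ _ _)).trans (le_of_eq (by ring)))

end decoupled

/-- The interactions of one mode of each of `p`, `q` with one of `a`. -/
noncomputable def quadraticPart (r : Freq × Freq × Freq → ℂ) (a p q : EllOne) : EllOne :=
  trilin r a p q + trilin r p a q + trilin r p q a

/-- The form whose diagonal is, up to a factor, a primitive of `quadraticPart` along a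
rotating `a`. -/
noncomputable def quadraticCorrector (r : Freq × Freq × Freq → ℂ) (a p q : EllOne) : EllOne :=
  trilin r a p q - trilin r p a q + trilin r p q a

section decoupled

variable {r : Freq × Freq × Freq → ℂ} {Λ : Set Freq} {a p p₀ q q₀ : EllOne}

theorem ZeroDecoupled.norm_quadraticPart_le (h : ZeroDecoupled r Λ) (hr : SymbolBound r 1)
    (ha : SupportedIn {0} a) (hp : SupportedIn Λ p₀) (hq : SupportedIn Λ q₀) :
    ‖quadraticPart r a p q‖ ≤ 3 * (‖a‖ * (‖p - p₀‖ * ‖q‖ + ‖p₀‖ * ‖q - q₀‖)) := by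
  have h1 := h.norm_left_le hr ha hp hq (p := p) (q := q)
  have h2 := h.norm_mid_le hr ha hp hq (p := p) (q := q)
  have h3 := h.norm_right_le hr ha hp hq (p := p) (q := q)
  refine norm_add₃_le.trans ?_
  linarith

theorem ZeroDecoupled.norm_quadraticCorrector_le (h : ZeroDecoupled r Λ) (hr : SymbolBound r 1)
    (ha : SupportedIn {0} a) (hp : SupportedIn Λ p₀) (hq : SupportedIn Λ q₀) :
    ‖quadraticCorrector r a p q‖ ≤ 3 * (‖a‖ * (‖p - p₀‖ * ‖q‖ + ‖p₀‖ * ‖q - q₀‖)) := by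
  have h1 := h.norm_left_le hr ha hp hq (p := p) (q := q)
  have h2 := h.norm_mid_le hr ha hp hq (p := p) (q := q)
  have h3 := h.norm_right_le hr ha hp hq (p := p) (q := q)
  have h4 := norm_sub_le (trilin r a p q) (trilin r p a q)
  refine (norm_add_le _ _).trans ?_
  linarith

end decoupled

/-- Rotation multiplies `a` by `-iω` but its conjugate by `+iω`. The minus sign on the middle slot
of the corrector makes all three contributions carry the same factor. -/
theorem hasDerivWithinAt_quadraticCorrector {r : Freq × Freq × Freq → ℂ} {C : ℝ}
    (hr : SymbolBound r C) {s : Set ℝ} {t ω : ℝ} {a v : ℝ → EllOne} {μ v' : EllOne}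
    (ha : HasDerivWithinAt a (-(Complex.I * ω) • a t + μ) s t)
    (hv : HasDerivWithinAt v v' s t) :
    HasDerivWithinAt (fun t => quadraticCorrector r (a t) (v t) (v t))
      (-(Complex.I * ω) • quadraticPart r (a t) (v t) (v t) +
        (quadraticCorrector r μ (v t) (v t) + quadraticCorrector r (a t) v' (v t) +
          quadraticCorrector r (a t) (v t) v')) s t := by
  have h1 := hasDerivWithinAt_trilin_const hr ha hv hv
  have h2 := hasDerivWithinAt_trilin_const hr hv ha hv
  have h3 := hasDerivWithinAt_trilin_const hr hv hv ha
  refine ((h1.sub h2).add h3).congr_deriv ?_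
  have hconj : starRingEnd ℂ (-(Complex.I * ω)) = Complex.I * ω := by simp
  rw [trilin_add_left hr _ μ, trilin_add_mid hr _ _ μ, trilin_add_right hr _ _ _ μ,
    trilin_smul_left hr, trilin_smul_mid hr, trilin_smul_right hr, hconj]
  simp only [quadraticPart, quadraticCorrector]
  module

/-- The rate of change of the corrected difference between a solution of the perturbed resonant
system and one of the resonant system. -/
theorem norm_rotating_rate_le {r : Freq × Freq × Freq → ℂ} {Λ : Set Freq}
    (hr : SymbolBound r 1) (hΛ : ZeroDecoupled r Λ) {A β m D : ℝ} (hA : 0 < A) (hβ : 0 < β)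
    (hβA : 800 * β ≤ A) (hmβ : 12 * m * β ≤ A ^ 2) {a v w μ ρ v' : EllOne}
    (hv' : v' = Complex.I • (quadraticPart r a v v + trilin r v v v) + ρ)
    (ha0 : SupportedIn {0} a) (hμ0 : SupportedIn {0} μ) (hwΛ : SupportedIn Λ w)
    (hwwΛ : SupportedIn Λ (trilin r w w w)) (haA : ‖a‖ ≤ 2 * A) (hμm : ‖μ‖ ≤ m * β ^ 2)
    (hvβ : ‖v‖ ≤ 3 * β) (hwβ : ‖w‖ ≤ β) (hρ : ‖ρ‖ ≤ D) :
    ‖Complex.I • (trilin r v v v - trilin r w w w) + ρ + (((A ^ 2)⁻¹ : ℝ) : ℂ) •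
      (quadraticCorrector r μ v v + quadraticCorrector r a v' v + quadraticCorrector r a v v')‖ ≤
      1500 * β ^ 2 * ‖v - w‖ + 2 * D := by
  have hA2 : 0 < A ^ 2 := by positivity
  have hD : 0 ≤ D := (norm_nonneg _).trans hρ
  have hm : 0 ≤ m * β ^ 2 := (norm_nonneg _).trans hμm
  obtain ⟨x, hx⟩ : ∃ x, x = ‖v - w‖ := ⟨_, rfl⟩
  have hx0 : 0 ≤ x := hx ▸ norm_nonneg _
  have hx4 : x ≤ 4 * β := by
    rw [hx]
    exact (norm_sub_le _ _).trans (by linarith)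
  have hquad : ‖v - w‖ * ‖v‖ + ‖w‖ * ‖v - w‖ ≤ 4 * β * x := by
    rw [← hx]
    have h1 : x * ‖v‖ ≤ x * (3 * β) := by gcongr
    have h2 : ‖w‖ * x ≤ β * x := by gcongr
    linarith
  have hquad0 : 0 ≤ ‖v - w‖ * ‖v‖ + ‖w‖ * ‖v - w‖ := by positivity
  have hcube : ‖trilin r v v v - trilin r w w w‖ ≤ 13 * β ^ 2 * x := by
    refine (norm_trilin_sub_trilin_le hr _ _ _ _ _ _).trans ?_
    rw [← hx]
    have h1 : x * (‖v‖ * ‖v‖) ≤ x * (3 * β * (3 * β)) := by gcongr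
    have h2 : ‖w‖ * (x * ‖v‖) ≤ β * (x * (3 * β)) := by gcongr
    have h3 : ‖w‖ * (‖w‖ * x) ≤ β * (β * x) := by gcongr
    linarith
  -- `p` is the derivative of `w`. It is supported in `Λ`, so decoupling also applies to the
  -- corrector terms containing `v'`, with `p` as reference point.
  obtain ⟨p, hp⟩ : ∃ p, p = Complex.I • trilin r w w w := ⟨_, rfl⟩
  have hpΛ : SupportedIn Λ p := hp ▸ hwwΛ.smul _
  have hpn : ‖p‖ ≤ β ^ 3 := by
    rw [hp, norm_smul, Complex.norm_I, one_mul]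
    refine (norm_trilin_le hr _ _ _).trans ?_
    calc 1 * (‖w‖ * (‖w‖ * ‖w‖)) ≤ 1 * (β * (β * β)) := by gcongr
      _ = β ^ 3 := by ring
  have hQ : ‖quadraticPart r a v v‖ ≤ 3 * (2 * A * (4 * β * x)) := by
    refine (hΛ.norm_quadraticPart_le hr ha0 hwΛ hwΛ).trans ?_
    gcongr
  obtain ⟨y, hy⟩ : ∃ y, y = ‖v' - p‖ := ⟨_, rfl⟩
  have hy0 : 0 ≤ y := hy ▸ norm_nonneg _
  have hyb : y ≤ 24 * A * β * x + 13 * β ^ 2 * x + D := by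
    have he : v' - p = Complex.I • quadraticPart r a v v +
        Complex.I • (trilin r v v v - trilin r w w w) + ρ := by
      rw [hv', hp]
      module
    rw [hy, he]
    refine norm_add₃_le.trans ?_
    rw [norm_smul, norm_smul, Complex.norm_I, one_mul, one_mul]
    linarith
  have hv'n : ‖v'‖ ≤ y + β ^ 3 := by
    have := norm_add_le (v' - p) p
    rw [sub_add_cancel] at this
    linarith
  have g1 : ‖quadraticCorrector r μ v v‖ ≤ 3 * (m * β ^ 2 * (4 * β * x)) := by
    refine (hΛ.norm_quadraticCorrector_le hr hμ0 hwΛ hwΛ).trans ?_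
    gcongr
  have g2 : ‖quadraticCorrector r a v' v‖ ≤ 3 * (2 * A * (5 * β * y + β ^ 3 * x)) := by
    refine (hΛ.norm_quadraticCorrector_le hr ha0 hpΛ hwΛ).trans ?_
    have h1 : ‖v' - p‖ * ‖v‖ ≤ y * (3 * β) := by rw [← hy]; gcongr
    have h2 : ‖p‖ * ‖v - w‖ ≤ β ^ 3 * x := by rw [← hx]; gcongr
    have h3 : 0 ≤ β * y := by positivity
    exact mul_le_mul_of_nonneg_left (mul_le_mul haA (by linarith) (by positivity)
      (by positivity)) (by norm_num)
  have g3 : ‖quadraticCorrector r a v v'‖ ≤ 3 * (2 * A * (5 * β * y + β ^ 3 * x)) := by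
    refine (hΛ.norm_quadraticCorrector_le hr ha0 hwΛ hpΛ).trans ?_
    have h1 : ‖v - w‖ * ‖v'‖ ≤ x * (y + β ^ 3) := by rw [← hx]; gcongr
    have h2 : ‖w‖ * ‖v' - p‖ ≤ β * y := by rw [← hy]; gcongr
    have h3 : x * y ≤ 4 * β * y := by gcongr
    exact mul_le_mul_of_nonneg_left (mul_le_mul haA (by linarith) (by positivity)
      (by positivity)) (by norm_num)
  have hSdiv : (A ^ 2)⁻¹ * ‖quadraticCorrector r μ v v + quadraticCorrector r a v' v +
      quadraticCorrector r a v v'‖ ≤ 1443 * β ^ 2 * x + D := by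
    rw [inv_mul_le_iff₀ hA2]
    refine norm_add₃_le.trans ((add_le_add (add_le_add g1 g2) g3).trans ?_)
    -- The leading cost is `12 · 5 · 24 = 1440`, from the `Aβx` part of `y`. The remaining cubic
    -- terms have coefficient `60 · 13 + 12 = 792`, whence the threshold `800 β ≤ A`.
    have k1 : 12 * m * β * (β ^ 2 * x) ≤ A ^ 2 * (β ^ 2 * x) := by gcongr
    have k2 : A * β * y ≤ A * β * (24 * A * β * x + 13 * β ^ 2 * x + D) := by gcongr
    have k3 : 800 * β * (A * (β ^ 2 * x)) ≤ A * (A * (β ^ 2 * x)) := by gcongr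
    have k4 : 800 * β * (A * D) ≤ A * (A * D) := by gcongr
    have k5 : 0 ≤ A * β * D := by positivity
    have k6 : 0 ≤ A * β ^ 3 * x := by positivity
    have k7 : 0 ≤ A ^ 2 * (β ^ 2 * x) := by positivity
    linarith
  refine norm_add₃_le.trans ?_
  rw [norm_smul, norm_smul, Complex.norm_I, one_mul, Complex.norm_real,
    Real.norm_of_nonneg (inv_nonneg.2 hA2.le), ← hx]
  have : 0 ≤ β ^ 2 * x := by positivity
  linarith

/-- Stability of the resonant system under the resonant interactions with a rotating zero mode:
these average out, because the zero mode rotates with speed `A²`. -/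
theorem norm_sub_le_of_rotating {r : Freq × Freq × Freq → ℂ} {Λ : Set Freq}
    (hr : SymbolBound r 1) (hΛ : ZeroDecoupled r Λ) {T A β m D D₀ : ℝ} (hA : 0 < A) (hβ : 0 < β)
    (hβA : 800 * β ≤ A) (hmβ : 12 * m * β ≤ A ^ 2) {a v w μ ρ : ℝ → EllOne}
    (ha : ∀ t ∈ Set.Icc 0 T, HasDerivWithinAt a
      (-(Complex.I * ((A ^ 2 : ℝ) : ℂ)) • a t + μ t) (Set.Icc 0 T) t)
    (hv : ∀ t ∈ Set.Icc 0 T, HasDerivWithinAt v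
      (Complex.I • (quadraticPart r (a t) (v t) (v t) + trilin r (v t) (v t) (v t)) + ρ t)
      (Set.Icc 0 T) t)
    (hw : ∀ t ∈ Set.Icc 0 T, HasDerivWithinAt w
      (Complex.I • trilin r (w t) (w t) (w t)) (Set.Icc 0 T) t)
    (ha0 : ∀ t ∈ Set.Icc 0 T, SupportedIn {0} (a t))
    (hμ0 : ∀ t ∈ Set.Icc 0 T, SupportedIn {0} (μ t))
    (hwΛ : ∀ t ∈ Set.Icc 0 T, SupportedIn Λ (w t))
    (hwwΛ : ∀ t ∈ Set.Icc 0 T, SupportedIn Λ (trilin r (w t) (w t) (w t)))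
    (haA : ∀ t ∈ Set.Icc 0 T, ‖a t‖ ≤ 2 * A)
    (hμm : ∀ t ∈ Set.Icc 0 T, ‖μ t‖ ≤ m * β ^ 2)
    (hvβ : ∀ t ∈ Set.Icc 0 T, ‖v t‖ ≤ 3 * β)
    (hwβ : ∀ t ∈ Set.Icc 0 T, ‖w t‖ ≤ β)
    (hρ : ∀ t ∈ Set.Icc 0 T, ‖ρ t‖ ≤ D)
    (h0 : ‖v 0 - w 0‖ ≤ D₀) :
    ∀ t ∈ Set.Icc 0 T,
      ‖v t - w t‖ ≤ 2 * gronwallBound (3 / 2 * D₀) (3000 * β ^ 2) (2 * D) t := by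
  have hA2 : 0 < A ^ 2 := by positivity
  have hcorr : ∀ t ∈ Set.Icc 0 T,
      ‖(((A ^ 2)⁻¹ : ℝ) : ℂ) • quadraticCorrector r (a t) (v t) (v t)‖ ≤
        1 / 2 * ‖v t - w t‖ := by
    intro t ht
    rw [norm_smul, Complex.norm_real, Real.norm_of_nonneg (inv_nonneg.2 hA2.le),
      inv_mul_le_iff₀ hA2]
    refine (hΛ.norm_quadraticCorrector_le hr (ha0 t ht) (hwΛ t ht) (hwΛ t ht)).trans ?_
    have h1 : ‖v t - w t‖ * ‖v t‖ ≤ ‖v t - w t‖ * (3 * β) := by gcongr; exact hvβ t ht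
    have h2 : ‖w t‖ * ‖v t - w t‖ ≤ β * ‖v t - w t‖ := by gcongr; exact hwβ t ht
    have h3 : ‖a t‖ * (‖v t - w t‖ * ‖v t‖ + ‖w t‖ * ‖v t - w t‖) ≤
        2 * A * (4 * β * ‖v t - w t‖) :=
      mul_le_mul (haA t ht) (by linarith) (by positivity) (by positivity)
    have h4 : 800 * β * (A * ‖v t - w t‖) ≤ A * (A * ‖v t - w t‖) := by gcongr
    have h5 : 0 ≤ β * (A * ‖v t - w t‖) := by positivity
    linarith
  -- The corrector is at most half of `‖v - w‖`, so `W` is comparable to `v - w`; Gronwall is run on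
  -- `W`, in whose derivative the quadratic part cancels.
  obtain ⟨W, hW⟩ : ∃ W : ℝ → EllOne, W = fun t =>
    v t - w t + (((A ^ 2)⁻¹ : ℝ) : ℂ) • quadraticCorrector r (a t) (v t) (v t) := ⟨_, rfl⟩
  have hVW : ∀ t ∈ Set.Icc 0 T, ‖v t - w t‖ ≤ 2 * ‖W t‖ := by
    intro t ht
    have h1 : v t - w t =
        W t - (((A ^ 2)⁻¹ : ℝ) : ℂ) • quadraticCorrector r (a t) (v t) (v t) := by
      rw [hW]
      exact (add_sub_cancel_right _ _).symm
    have h2 := norm_sub_le (W t)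
      ((((A ^ 2)⁻¹ : ℝ) : ℂ) • quadraticCorrector r (a t) (v t) (v t))
    rw [← h1] at h2
    linarith [hcorr t ht]
  intro t ht
  have h00 : (0 : ℝ) ∈ Set.Icc 0 T := ⟨le_rfl, ht.1.trans ht.2⟩
  have hW0 : ‖W 0‖ ≤ 3 / 2 * D₀ := by
    rw [hW]
    refine (norm_add_le _ _).trans ?_
    linarith [hcorr 0 h00]
  have hder : ∀ t ∈ Set.Icc 0 T, HasDerivWithinAt W _ (Set.Icc 0 T) t := fun t ht => by
    rw [hW]
    exact ((hv t ht).sub (hw t ht)).add ((hasDerivWithinAt_quadraticCorrector hr (ha t ht)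
      (hv t ht)).const_smul (((A ^ 2)⁻¹ : ℝ) : ℂ))
  have := norm_le_gronwallBound_Icc hder hW0 (K := 3000 * β ^ 2) (ε := 2 * D)
    (fun t ht => ?_) t ht
  · linarith [hVW t ht]
  · have hrate := norm_rotating_rate_le hr hΛ hA hβ hβA hmβ rfl (ha0 t ht) (hμ0 t ht) (hwΛ t ht)
      (hwwΛ t ht) (haA t ht) (hμm t ht) (hvβ t ht) (hwβ t ht) (hρ t ht)
    have hxW : β ^ 2 * ‖v t - w t‖ ≤ β ^ 2 * (2 * ‖W t‖) := by gcongr; exact hVW t ht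
    refine (le_of_eq ?_).trans (hrate.trans (by linarith))
    congr 1
    have hAA : (((A ^ 2)⁻¹ : ℝ) : ℂ) * -(Complex.I * ((A ^ 2 : ℝ) : ℂ)) = -Complex.I := by
      have : (A : ℂ) ≠ 0 := by exact_mod_cast hA.ne'
      push_cast
      field_simp
    rw [smul_add (((A ^ 2)⁻¹ : ℝ) : ℂ), smul_smul, hAA]
    module

end EllOne

/-! ### Resonances on `Nℤ²`: slow and fast interactions. -/

/-- The dilated lattice `Nℤ²`. -/
def dilatedLattice (N : ℕ) : Set Freq := {n | (N : ℤ) ∣ n.1 ∧ (N : ℤ) ∣ n.2}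

/-- This factorisation gives both divisibility by `N²` on `Nℤ²` and the reading of resonance as a
right angle at `n₂`. -/
theorem resonance_eq (k : Freq × Freq × Freq) :
    resonance k = -2 * Freq.dot (k.1 - k.2.1) (k.2.2 - k.2.1) := by
  obtain ⟨⟨a1, a2⟩, ⟨b1, b2⟩, ⟨c1, c2⟩⟩ := k
  simp only [resonance, omegaFour, outFreq, Freq.normSq, Freq.dot, Prod.fst_sub, Prod.snd_sub,
    Prod.fst_add, Prod.snd_add]
  ring

theorem sq_dvd_resonance {N : ℕ} {k : Freq × Freq × Freq} (h1 : k.1 ∈ dilatedLattice N)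
    (h2 : k.2.1 ∈ dilatedLattice N) (h3 : k.2.2 ∈ dilatedLattice N) :
    (N : ℤ) ^ 2 ∣ resonance k := by
  rw [resonance_eq, sq]
  refine Dvd.dvd.mul_left (dvd_add ?_ ?_) _
  · exact mul_dvd_mul (dvd_sub h1.1 h2.1) (dvd_sub h3.1 h2.1)
  · exact mul_dvd_mul (dvd_sub h1.2 h2.2) (dvd_sub h3.2 h2.2)

theorem outFreq_mem_dilatedLattice {N : ℕ} {k : Freq × Freq × Freq}
    (h1 : k.1 ∈ dilatedLattice N) (h2 : k.2.1 ∈ dilatedLattice N)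
    (h3 : k.2.2 ∈ dilatedLattice N) : outFreq k ∈ dilatedLattice N :=
  ⟨dvd_add (dvd_sub h1.1 h2.1) h3.1, dvd_add (dvd_sub h1.2 h2.2) h3.2⟩

theorem isRectangle_of_resonance_eq_zero {k : Freq × Freq × Freq} (h : resonance k = 0)
    (h1 : k.1 ≠ k.2.1) (h2 : k.2.1 ≠ k.2.2) : IsRectangle k.1 k.2.1 k.2.2 (outFreq k) := by
  rw [resonance_eq] at h
  refine ⟨?_, by omega, h1, h2.symm⟩
  simp only [outFreq]
  abel

theorem interactionSign_eq_zero {k : Freq × Freq × Freq}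
    (h1 : ¬(k.1 = k.2.1 ∧ k.2.1 = k.2.2)) (h2 : ¬(k.1 ≠ k.2.1 ∧ k.2.1 ≠ k.2.2)) :
    interactionSign k = 0 := by rw [interactionSign, if_neg h1, if_neg h2]

theorem rfnlsSymbol_cases (k : Freq × Freq × Freq) :
    rfnlsSymbol k = 0 ∨ (k.1 = k.2.1 ∧ k.2.1 = k.2.2) ∨
      (k.1 ≠ k.2.1 ∧ k.2.1 ≠ k.2.2 ∧ IsRectangle k.1 k.2.1 k.2.2 (outFreq k)) := by
  by_cases h0 : resonance k = 0
  · by_cases h1 : k.1 = k.2.1 ∧ k.2.1 = k.2.2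
    · exact Or.inr (Or.inl h1)
    · by_cases h2 : k.1 ≠ k.2.1 ∧ k.2.1 ≠ k.2.2
      · exact Or.inr (Or.inr ⟨h2.1, h2.2, isRectangle_of_resonance_eq_zero h0 h2.1 h2.2⟩)
      · exact Or.inl (by rw [rfnlsSymbol, interactionSign_eq_zero h1 h2, zero_mul])
  · exact Or.inl (by rw [rfnlsSymbol, if_neg h0, mul_zero])

/-- The resonant interactions with nonzero output. -/
def slowSymbol (k : Freq × Freq × Freq) : ℂ := if outFreq k = 0 then 0 else rfnlsSymbol k

theorem symbolBound_slow : EllOne.SymbolBound slowSymbol 1 := fun k => by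
  rw [slowSymbol]
  split_ifs
  · simp
  · exact symbolBound_rfnls k

theorem dot_self_eq_zero {n : Freq} (h : Freq.dot n n = 0) : n = 0 := by
  obtain ⟨a, b⟩ := n
  simp only [Freq.dot] at h
  have ha : a = 0 := by nlinarith [mul_self_nonneg a, mul_self_nonneg b]
  have hb : b = 0 := by nlinarith [mul_self_nonneg a, mul_self_nonneg b]
  rw [ha, hb]; rfl

/-- Here the output equals `n₃`, a case excluded from `Γ` unless `n₃ = 0`, and then the output is
zero. -/
theorem slowSymbol_eq_zero_of_left {k : Freq × Freq × Freq} (h1 : k.1 = 0) (h2 : k.2.1 = 0) :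
    slowSymbol k = 0 := by
  obtain ⟨a, b, c⟩ := k
  simp only at h1 h2
  subst h1 h2
  rw [slowSymbol]
  split_ifs with h
  · rfl
  · have hc : (0 : Freq) ≠ c := fun e => h (by simp [outFreq, ← e])
    rw [rfnlsSymbol, interactionSign_eq_zero (fun e => hc e.2) (fun e => e.1 rfl), zero_mul]

theorem slowSymbol_eq_zero_of_right {k : Freq × Freq × Freq} (h1 : k.2.1 = 0)
    (h2 : k.2.2 = 0) : slowSymbol k = 0 := by
  obtain ⟨a, b, c⟩ := k
  simp only at h1 h2
  subst h1 h2
  rw [slowSymbol]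
  split_ifs with h
  · rfl
  · have hc : a ≠ (0 : Freq) := fun e => h (by simp [outFreq, e])
    rw [rfnlsSymbol, interactionSign_eq_zero (fun e => hc e.1) (fun e => e.2 rfl), zero_mul]

/-- Here `ω₄ = -2|n₂|²`, so resonance forces `n₂ = 0` and hence zero output. -/
theorem slowSymbol_eq_zero_of_ends {k : Freq × Freq × Freq} (h1 : k.1 = 0)
    (h2 : k.2.2 = 0) : slowSymbol k = 0 := by
  obtain ⟨a, b, c⟩ := k
  simp only at h1 h2
  subst h1 h2
  rw [slowSymbol]
  split_ifs with h
  · rfl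
  · rw [rfnlsSymbol, if_neg, mul_zero]
    rw [resonance_eq]
    intro h0
    have : Freq.dot (0 - b) (0 - b) = 0 := by simpa using h0
    exact h (by simpa [outFreq] using dot_self_eq_zero this)

/-- The nonresonant interactions of `Nℤ²` with nonzero output. -/
def IsFast (N : ℕ) (k : Freq × Freq × Freq) : Prop :=
  outFreq k ≠ 0 ∧ resonance k ≠ 0 ∧
    k.1 ∈ dilatedLattice N ∧ k.2.1 ∈ dilatedLattice N ∧ k.2.2 ∈ dilatedLattice N

open scoped Classical in
/-- The symbol of the nonresonant interactions with nonzero output. -/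
noncomputable def fastSymbol (N : ℕ) (t : ℝ) (k : Freq × Freq × Freq) : ℂ :=
  if IsFast N k then fnlsSymbol t k else 0

open scoped Classical in
/-- A primitive in time of `fastSymbol`. -/
noncomputable def fastPrimitive (N : ℕ) (t : ℝ) (k : Freq × Freq × Freq) : ℂ :=
  if IsFast N k then (Complex.I * resonance k)⁻¹ * fnlsSymbol t k else 0

theorem symbolBound_fast (N : ℕ) (t : ℝ) : EllOne.SymbolBound (fastSymbol N t) 1 := fun k => by
  rw [fastSymbol]
  split_ifs
  · exact symbolBound_fnls t k
  · simp

/-- A nonzero multiple of `N²` has modulus at least `N²`: this is the gain from the dilated lattice.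
-/
theorem symbolBound_fastPrimitive {N : ℕ} (hN : 0 < N) (t : ℝ) :
    EllOne.SymbolBound (fastPrimitive N t) (1 / (N : ℝ) ^ 2) := fun k => by
  rw [fastPrimitive]
  have hN' : (0 : ℝ) < (N : ℝ) ^ 2 := by positivity
  split_ifs with h
  · have h1 : ((N : ℤ) ^ 2) ≤ |resonance k| :=
      Int.le_of_dvd (abs_pos.2 h.2.1)
        ((dvd_abs _ _).2 (sq_dvd_resonance h.2.2.1 h.2.2.2.1 h.2.2.2.2))
    have h2 : (N : ℝ) ^ 2 ≤ ‖(Complex.I * resonance k)‖ := by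
      rw [norm_mul, Complex.norm_I, one_mul, Complex.norm_intCast]
      exact_mod_cast h1
    rw [norm_mul, norm_inv, one_div]
    have h3 := symbolBound_fnls t k
    calc ‖(Complex.I * resonance k)‖⁻¹ * ‖fnlsSymbol t k‖
        ≤ ((N : ℝ) ^ 2)⁻¹ * 1 := by gcongr
      _ = _ := mul_one _
  · simp

theorem hasDerivAt_fastPrimitive (N : ℕ) (k : Freq × Freq × Freq) (t : ℝ) :
    HasDerivAt (fun t => fastPrimitive N t k) (fastSymbol N t k) t := by
  simp only [fastPrimitive, fastSymbol]
  split_ifs with h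
  · have hr : (resonance k : ℂ) ≠ 0 := by exact_mod_cast h.2.1
    refine (((hasDerivAt_phase k t).const_mul (interactionSign k)).const_mul
      ((Complex.I * resonance k)⁻¹)).congr_deriv ?_
    rw [fnlsSymbol]
    field_simp
  · exact hasDerivAt_const _ _

theorem fastPrimitive_zero (N : ℕ) (t : ℝ) (k : Freq × Freq × Freq) (h1 : k.1 = 0)
    (h2 : k.2.1 = 0) (h3 : k.2.2 = 0) : fastPrimitive N t k = 0 := by
  rw [fastPrimitive, if_neg]
  intro h
  exact h.1 (by simp [outFreq, h1, h2, h3])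

namespace EllOne

theorem SupportedIn.eq_zero {x : EllOne} (h : SupportedIn {0} x) {n : Freq} (hn : x n ≠ 0) :
    n = 0 := h.mem hn

theorem restrict_compl_trilin_fnls {N : ℕ} (t : ℝ) {x : EllOne}
    (hx : SupportedIn (dilatedLattice N) x) :
    restrict {0}ᶜ (trilin (fnlsSymbol t) x x x) =
      trilin slowSymbol x x x + trilin (fastSymbol N t) x x x := by
  have hψ : SymbolBound (fun k => if outFreq k = 0 then 0 else fnlsSymbol t k) 1 := fun k => by
    simp only []
    split_ifs
    · simp
    · exact symbolBound_fnls t k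
  rw [restrict_trilin (symbolBound_fnls t) hψ (fun k hk => if_neg hk)
    (fun k hk => if_pos (not_not.1 hk)), ← trilin_add_symbol symbolBound_slow (symbolBound_fast N t)]
  refine trilin_congr fun k h1 h2 h3 => ?_
  simp only [Pi.add_apply, slowSymbol, fastSymbol]
  by_cases h0 : outFreq k = 0
  · rw [if_pos h0, if_pos h0, if_neg (fun h => h.1 h0), add_zero]
  rw [if_neg h0, if_neg h0]
  by_cases hr : resonance k = 0
  · rw [if_neg (fun h => h.2.1 hr), add_zero, rfnlsSymbol, if_pos hr, fnlsSymbol, phase, hr]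
    simp
  · rw [if_pos ⟨h0, hr, hx.mem h1, hx.mem h2, hx.mem h3⟩, rfnlsSymbol, if_neg hr, mul_zero,
      zero_add]

/-- Expanding `c` into zero and nonzero modes, all terms with two or more zero modes vanish. -/
theorem trilin_slow_eq (c : EllOne) : trilin slowSymbol c c c =
    quadraticPart slowSymbol (restrict {0} c) (restrict {0}ᶜ c) (restrict {0}ᶜ c) +
      trilin slowSymbol (restrict {0}ᶜ c) (restrict {0}ᶜ c) (restrict {0}ᶜ c) := by
  have hr := symbolBound_slow
  set a := restrict {0} c with ha
  set b := restrict {0}ᶜ c with hb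
  have hc : c = a + b := (restrict_add_restrict_compl {0} c).symm
  have ha0 : SupportedIn {0} a := supportedIn_restrict _ _
  have z1 : ∀ x, trilin slowSymbol a a x = 0 := fun x => trilin_eq_zero fun k h1 h2 _ =>
    slowSymbol_eq_zero_of_left (ha0.eq_zero h1) (ha0.eq_zero h2)
  have z2 : ∀ x, trilin slowSymbol x a a = 0 := fun x => trilin_eq_zero fun k _ h1 h2 =>
    slowSymbol_eq_zero_of_right (ha0.eq_zero h1) (ha0.eq_zero h2)
  have z3 : ∀ x, trilin slowSymbol a x a = 0 := fun x => trilin_eq_zero fun k h1 _ h2 =>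
    slowSymbol_eq_zero_of_ends (ha0.eq_zero h1) (ha0.eq_zero h2)
  conv_lhs => rw [hc]
  simp only [trilin_add_left hr, trilin_add_mid hr, trilin_add_right hr, z1, z2, z3,
    quadraticPart]
  abel

/-- A symbol without the interaction of three zero modes always involves a nonzero mode. -/
theorem norm_trilin_le_of_zero {φ : Freq × Freq × Freq → ℂ} {C : ℝ} (hφ : SymbolBound φ C)
    (h : ∀ k, k.1 = 0 → k.2.1 = 0 → k.2.2 = 0 → φ k = 0) (x y z : EllOne) :
    ‖trilin φ x y z‖ ≤ C * (‖restrict {0}ᶜ x‖ * (‖y‖ * ‖z‖) + ‖x‖ * (‖restrict {0}ᶜ y‖ * ‖z‖) +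
      ‖x‖ * (‖y‖ * ‖restrict {0}ᶜ z‖)) := by
  have h0 : trilin φ (restrict {0} x) (restrict {0} y) (restrict {0} z) = 0 :=
    trilin_eq_zero fun k h1 h2 h3 => h k ((supportedIn_restrict _ _).eq_zero h1)
      ((supportedIn_restrict _ _).eq_zero h2) ((supportedIn_restrict _ _).eq_zero h3)
  have hs : ∀ u : EllOne, u - restrict {0} u = restrict {0}ᶜ u := fun u => by
    rw [sub_eq_iff_eq_add', restrict_add_restrict_compl]
  have hn : ∀ u : EllOne, ‖restrict {0} u‖ ≤ ‖u‖ := norm_restrict_le _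
  have hC := hφ.nonneg
  have h1 := norm_trilin_sub_trilin_le hφ (restrict {0} x) (restrict {0} y) (restrict {0} z) x y z
  rw [h0, sub_zero, hs, hs, hs] at h1
  refine h1.trans ?_
  have := hn x
  have := hn y
  gcongr

end EllOne

/-! ### Consequences of Properties II and VIII. -/

section good

variable {P : ℕ} {gen : ℕ → Finset Freq}

theorem IsGoodFrequencySet.rfnlsSymbol_eq_zero (hg : IsGoodFrequencySet P gen)
    {k : Freq × Freq × Freq} (h1 : k.1 ∈ allGenerations P gen)
    (h2 : k.2.1 ∈ allGenerations P gen) (h3 : k.2.2 ∈ allGenerations P gen)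
    (h : outFreq k ∉ allGenerations P gen) : rfnlsSymbol k = 0 := by
  rcases rfnlsSymbol_cases k with h0 | h0 | h0
  · exact h0
  · exact absurd (by simpa [outFreq, h0.1, h0.2] using h3) h
  · exact absurd (hg.closure_rectangle _ _ _ _ h0.2.2 h1 h2 h3) h

/-- A resonant interaction of the zero mode with two modes of `Λ` would be a rectangle with a vertex
at `0` and two vertices in `Λ`. The diagonal interactions are excluded since `0 ∉ Λ`. -/
theorem IsGoodFrequencySet.zeroDecoupled (hg : IsGoodFrequencySet P gen)
    (h0 : (0 : Freq) ∉ allGenerations P gen) :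
    EllOne.ZeroDecoupled slowSymbol {n | n ∈ allGenerations P gen} := by
  have hne : ∀ n ∈ allGenerations P gen, n ≠ 0 := fun n hn e => h0 (e ▸ hn)
  refine ⟨fun a x y ha hx hy => ?_, fun a x y ha hx hy => ?_, fun a x y ha hx hy => ?_⟩
  · refine EllOne.trilin_eq_zero fun k h1 h2 h3 => ?_
    have k1 : k.1 = 0 := ha.eq_zero h1
    have k2 : k.2.1 ∈ allGenerations P gen := hx.mem h2
    have k3 : k.2.2 ∈ allGenerations P gen := hy.mem h3
    rw [slowSymbol]
    split_ifs
    · rfl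
    rcases rfnlsSymbol_cases k with h | h | h
    · exact h
    · exact absurd (h.1.symm.trans k1) (hne _ k2)
    · have hR := h.2.2
      rw [k1] at hR
      exact absurd ⟨k2, k3⟩ (hg.no_rectangle_zero _ _ _ hR).1
  · refine EllOne.trilin_eq_zero fun k h1 h2 h3 => ?_
    have k1 : k.1 ∈ allGenerations P gen := hx.mem h1
    have k2 : k.2.1 = 0 := ha.eq_zero h2
    have k3 : k.2.2 ∈ allGenerations P gen := hy.mem h3
    rw [slowSymbol]
    split_ifs
    · rfl
    rcases rfnlsSymbol_cases k with h | h | h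
    · exact h
    · exact absurd (h.1.trans k2) (hne _ k1)
    · obtain ⟨e1, e2, e3, e4⟩ := h.2.2
      have hout : outFreq k = k.1 + k.2.2 := by simp [outFreq, k2]
      -- With `0` in the middle slot, the right angle is at `0`, and the two modes of `Λ` are its
      -- neighbours.
      have hR : IsRectangle 0 k.1 (k.1 + k.2.2) k.2.2 := by
        rw [k2] at e2 e3 e4
        refine ⟨by abel, ?_, e3.symm, fun e => e4 (by simpa using e)⟩
        rw [Freq.dot] at e2 ⊢
        simp only [Prod.fst_sub, Prod.snd_sub, Prod.fst_add, Prod.snd_add, Prod.fst_zero,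
          Prod.snd_zero] at e2 ⊢
        linarith
      exact absurd ⟨k1, k3⟩ (hg.no_rectangle_zero _ _ _ hR).2.1
  · refine EllOne.trilin_eq_zero fun k h1 h2 h3 => ?_
    have k1 : k.1 ∈ allGenerations P gen := hx.mem h1
    have k2 : k.2.1 ∈ allGenerations P gen := hy.mem h2
    have k3 : k.2.2 = 0 := ha.eq_zero h3
    rw [slowSymbol]
    split_ifs
    · rfl
    rcases rfnlsSymbol_cases k with h | h | h
    · exact h
    · exact absurd (h.2.trans k3) (hne _ k2)
    · obtain ⟨e1, e2, e3, e4⟩ := h.2.2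
      have hR : IsRectangle 0 k.2.1 k.1 (outFreq k) := by
        rw [k3] at e1 e2 e4
        refine ⟨by rw [← e1]; abel, ?_, e4, e3⟩
        rw [Freq.dot] at e2 ⊢
        linarith
      exact absurd ⟨k2, k1⟩ (hg.no_rectangle_zero _ _ _ hR).1

end good

/-! ### Rotation of the zero mode. -/

namespace EllOne

theorem norm_restrict_zero (x : EllOne) : ‖restrict {0} x‖ = ‖x 0‖ := by
  have h : restrict {0} x = lp.single 1 0 (x 0) := by
    refine ext_apply fun n => ?_
    by_cases hn : n = 0
    · rw [hn, restrict_of_mem (Set.mem_singleton 0), lp.single_apply_self]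
    · rw [restrict_of_notMem (S := {0}) hn, lp.single_apply_ne _ _ _ hn]
  rw [h, lp.norm_single (by simp)]

theorem trilin_zero_left {φ : Freq × Freq × Freq → ℂ} {C : ℝ} (hφ : SymbolBound φ C)
    (x : EllOne) (h0 : φ (0, 0, 0) = -1)
    (h : ∀ k, k.1 = 0 → k ≠ (0, 0, 0) → φ k = 0) :
    trilin φ (restrict {0} x) x x = -(‖x 0‖ : ℂ) ^ 2 • restrict {0} x := by
  refine ext_apply fun n => ?_
  rw [trilin_apply hφ, tsum_eq_single (0, 0, 0), smul_apply]
  · by_cases hn : n = 0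
    · subst hn
      rw [if_pos (by simp [outFreq]), h0, restrict_of_mem (Set.mem_singleton 0),
        ← Complex.mul_conj']
      ring
    · rw [if_neg (fun e => hn (by rw [← e]; simp [outFreq])), restrict_of_notMem (S := {0}) hn,
        mul_zero]
  · intro k hk
    split_ifs
    · by_cases h1 : k.1 = 0
      · rw [h k h1 hk, zero_mul]
      · rw [restrict_of_notMem (S := {0}) h1]; ring
    · rfl

/-- The zero mode rotates with speed `|c₀|²`, up to an error which is quadratic in the nonzero
modes. -/
theorem norm_restrict_zero_trilin_add_le (t : ℝ) (c : EllOne) :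
    ‖restrict {0} (trilin (fnlsSymbol t) c c c) + (‖c 0‖ : ℂ) ^ 2 • restrict {0} c‖ ≤
      ‖restrict {0}ᶜ c‖ ^ 2 * ‖c‖ := by
  obtain ⟨ψ, hψ⟩ : ∃ ψ : Freq × Freq × Freq → ℂ,
      ψ = fun k => if outFreq k = 0 then fnlsSymbol t k else 0 := ⟨_, rfl⟩
  have hψ1 : SymbolBound ψ 1 := fun k => by
    rw [hψ]
    simp only []
    split_ifs
    · exact symbolBound_fnls t k
    · simp
  -- With zero output, `n₁ = 0` forces `n₂ = n₃` and `n₃ = 0` forces `n₁ = n₂`, both excluded off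
  -- the diagonal. Apart from `(0, 0, 0)`, only interactions with `n₁` and `n₃` both nonzero
  -- survive, hence the quadratic error.
  have hzero : ∀ k : Freq × Freq × Freq, k.1 = 0 ∨ k.2.2 = 0 → k ≠ (0, 0, 0) → ψ k = 0 := by
    rintro ⟨a, b, c⟩ hk hne
    rw [hψ]
    simp only []
    split_ifs with ho
    · rw [fnlsSymbol, interactionSign_eq_zero, zero_mul]
      · rintro ⟨e1, e2⟩
        simp only at e1 e2 hk
        subst e1 e2
        rcases hk with hk | hk <;> exact hne (by rw [hk])
      · rintro ⟨e1, e2⟩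
        simp only [outFreq] at e1 e2 hk ho
        rcases hk with hk | hk
        · exact e2 (by linear_combination hk - ho)
        · exact e1 (by linear_combination ho - hk)
    · rfl
  have h1 : restrict {0} (trilin (fnlsSymbol t) c c c) = trilin ψ c c c :=
    restrict_trilin (symbolBound_fnls t) hψ1 (fun k hk => by rw [hψ]; exact if_pos hk)
      (fun k hk => by rw [hψ]; exact if_neg hk) c c c
  have h00 : ψ (0, 0, 0) = -1 := by
    rw [hψ]
    simp [outFreq, fnlsSymbol, interactionSign, phase, resonance_diag]
  have ha := trilin_zero_left hψ1 c h00 fun k hk => hzero k (Or.inl hk)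
  have hb : trilin ψ (restrict {0}ᶜ c) c (restrict {0} c) = 0 :=
    trilin_eq_zero fun k g1 _ g3 => hzero k (Or.inr ((supportedIn_restrict _ _).eq_zero g3))
      fun e => mem_of_restrict_ne_zero g1 (by rw [e]; rfl)
  have h2 : trilin ψ c c c = trilin ψ (restrict {0} c) c c +
      trilin ψ (restrict {0}ᶜ c) c (restrict {0}ᶜ c) := by
    have e1 := trilin_add_left hψ1 (restrict {0} c) (restrict {0}ᶜ c) c c
    have e2 := trilin_add_right hψ1 (restrict {0}ᶜ c) c (restrict {0} c) (restrict {0}ᶜ c)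
    rw [restrict_add_restrict_compl] at e1 e2
    rw [e1, e2, hb, zero_add]
  rw [h1, h2, ha]
  have h3 : -(‖c 0‖ : ℂ) ^ 2 • restrict {0} c + trilin ψ (restrict {0}ᶜ c) c (restrict {0}ᶜ c) +
      (‖c 0‖ : ℂ) ^ 2 • restrict {0} c = trilin ψ (restrict {0}ᶜ c) c (restrict {0}ᶜ c) := by
    module
  rw [h3]
  exact (norm_trilin_le hψ1 _ _ _).trans (le_of_eq (by ring))

end EllOne

/-! ### Comparison of the two systems under a priori bounds. -/

namespace EllOne

theorem norm_le_of_restrict (x : EllOne) : ‖x‖ ≤ ‖x 0‖ + ‖restrict {0}ᶜ x‖ := by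
  have := norm_add_le (restrict {0} x) (restrict {0}ᶜ x)
  rwa [restrict_add_restrict_compl, norm_restrict_zero] at this

theorem restrict_compl_eq {x y : EllOne} (h : ∀ n, n ≠ 0 → x n = y n) (h0 : y 0 = 0) :
    restrict {0}ᶜ x = y := by
  refine ext_apply fun n => ?_
  by_cases hn : n = 0
  · rw [hn, restrict_of_notMem (S := {0}ᶜ) (not_not.2 (Set.mem_singleton 0)), h0]
  · rw [restrict_of_mem (S := {0}ᶜ) hn, h n hn]

/-- Replacing `b` by `v` in the resonant nonlinearity. -/
theorem norm_slow_sub_le {a b v : EllOne} {M β d : ℝ} (hM : 1 ≤ M) (hβ1 : β ≤ 1)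
    (ha : ‖a‖ ≤ M) (hb : ‖b‖ ≤ 3 * β) (hv : ‖v‖ ≤ 3 * β) (hbv : ‖b - v‖ ≤ d) :
    ‖quadraticPart slowSymbol a b b + trilin slowSymbol b b b -
      (quadraticPart slowSymbol a v v + trilin slowSymbol v v v)‖ ≤ 45 * M * d := by
  have hr := symbolBound_slow
  have hd : 0 ≤ d := (norm_nonneg _).trans hbv
  have hb3 : ‖b‖ ≤ 3 := by linarith
  have hv3 : ‖v‖ ≤ 3 := by linarith
  have h1 : ‖trilin slowSymbol a b b - trilin slowSymbol a v v‖ ≤ 6 * M * d := by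
    refine (norm_trilin_sub_trilin_le hr _ _ _ _ _ _).trans ?_
    rw [sub_self, norm_zero]
    have e1 : ‖a‖ * (‖b - v‖ * ‖b‖) ≤ M * (d * 3) := by gcongr
    have e2 : ‖a‖ * (‖v‖ * ‖b - v‖) ≤ M * (3 * d) := by gcongr
    linarith
  have h2 : ‖trilin slowSymbol b a b - trilin slowSymbol v a v‖ ≤ 6 * M * d := by
    refine (norm_trilin_sub_trilin_le hr _ _ _ _ _ _).trans ?_
    rw [sub_self, norm_zero]
    have e1 : ‖b - v‖ * (‖a‖ * ‖b‖) ≤ d * (M * 3) := by gcongr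
    have e2 : ‖v‖ * (‖a‖ * ‖b - v‖) ≤ 3 * (M * d) := by gcongr
    linarith
  have h3 : ‖trilin slowSymbol b b a - trilin slowSymbol v v a‖ ≤ 6 * M * d := by
    refine (norm_trilin_sub_trilin_le hr _ _ _ _ _ _).trans ?_
    rw [sub_self, norm_zero]
    have e1 : ‖b - v‖ * (‖b‖ * ‖a‖) ≤ d * (3 * M) := by gcongr
    have e2 : ‖v‖ * (‖b - v‖ * ‖a‖) ≤ 3 * (d * M) := by gcongr
    linarith
  have h4 : ‖trilin slowSymbol b b b - trilin slowSymbol v v v‖ ≤ 27 * M * d := by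
    refine (norm_trilin_sub_trilin_le hr _ _ _ _ _ _).trans ?_
    have e1 : ‖b - v‖ * (‖b‖ * ‖b‖) ≤ d * (3 * 3) := by gcongr
    have e2 : ‖v‖ * (‖b - v‖ * ‖b‖) ≤ 3 * (d * 3) := by gcongr
    have e3 : ‖v‖ * (‖v‖ * ‖b - v‖) ≤ 3 * (3 * d) := by gcongr
    have e4 : d ≤ M * d := le_mul_of_one_le_left hd hM
    linarith
  have he : quadraticPart slowSymbol a b b + trilin slowSymbol b b b -
      (quadraticPart slowSymbol a v v + trilin slowSymbol v v v) =
      (trilin slowSymbol a b b - trilin slowSymbol a v v) +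
      (trilin slowSymbol b a b - trilin slowSymbol v a v) +
      (trilin slowSymbol b b a - trilin slowSymbol v v a) +
      (trilin slowSymbol b b b - trilin slowSymbol v v v) := by
    simp only [quadraticPart]
    abel
  rw [he]
  refine (norm_add_le _ _).trans ((add_le_add norm_add₃_le le_rfl).trans ?_)
  linarith

theorem norm_fastPrimitive_triple_le {N : ℕ} (hN : 0 < N) (t : ℝ) {x y z : EllOne}
    {X Y Z X' Y' Z' : ℝ} (hx : ‖x‖ ≤ X) (hy : ‖y‖ ≤ Y) (hz : ‖z‖ ≤ Z)
    (hx' : ‖restrict {0}ᶜ x‖ ≤ X') (hy' : ‖restrict {0}ᶜ y‖ ≤ Y')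
    (hz' : ‖restrict {0}ᶜ z‖ ≤ Z') : ‖trilin (fastPrimitive N t) x y z‖ ≤
      1 / (N : ℝ) ^ 2 * (X' * (Y * Z) + X * (Y' * Z) + X * (Y * Z')) := by
  have hX : 0 ≤ X := (norm_nonneg _).trans hx
  have hY : 0 ≤ Y := (norm_nonneg _).trans hy
  have hX' : 0 ≤ X' := (norm_nonneg _).trans hx'
  have hY' : 0 ≤ Y' := (norm_nonneg _).trans hy'
  refine (norm_trilin_le_of_zero (symbolBound_fastPrimitive hN t) (fastPrimitive_zero N t)
    x y z).trans ?_
  gcongr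

/-- A priori comparison of the nonzero modes of a solution of `FNLS` with a solution of
`RFNLS`, under bounds for both. -/
theorem norm_restrict_compl_sub_le {P : ℕ} {gen : ℕ → Finset Freq}
    (hg : IsGoodFrequencySet P gen) {N : ℕ} (hN : 0 < N)
    (hlat : ∀ n ∈ allGenerations P gen, n ∈ puncturedLattice N) {T A M β : ℝ} (hA : 0 < A)
    (hM : 1 ≤ M) (hβ : 0 < β) (hβ1 : β ≤ 1) (hβA : 800 * β ≤ A) (hMβ : 144 * M * β ≤ A ^ 2)
    (hMβ1 : 6 * M ^ 2 * β ^ 2 ≤ 1) (hNβ : 1 / (N : ℝ) ^ 2 ≤ β ^ 2) {c w : ℝ → EllOne}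
    (hc : SolvesCubic fnlsSymbol T c) (hw : SolvesCubic (fun _ => rfnlsSymbol) T w)
    (hc0 : ‖c 0 0‖ = A) (hcw : ∀ n, n ≠ 0 → c 0 n = w 0 n)
    (hw0 : SupportedIn {n | n ∈ allGenerations P gen} (w 0))
    (hwβ : ∀ t ∈ Set.Icc 0 T, ‖w t‖ ≤ β) (hcM : ∀ t ∈ Set.Icc 0 T, ‖c t‖ ≤ M)
    (hbβ : ∀ t ∈ Set.Icc 0 T, ‖restrict {0}ᶜ (c t)‖ ≤ 2 * β) :
    ∀ t ∈ Set.Icc 0 T, ‖restrict {0}ᶜ (c t) - w t‖ ≤ 6 * M ^ 2 * (1 / (N : ℝ) ^ 2 * β) +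
      2 * gronwallBound (9 * M ^ 2 * (1 / (N : ℝ) ^ 2 * β)) (3000 * β ^ 2)
        (600 * M ^ 4 * (1 / (N : ℝ) ^ 2 * β)) t := by
  obtain ⟨δ, hδ⟩ : ∃ δ, δ = 1 / (N : ℝ) ^ 2 := ⟨_, rfl⟩
  rw [← hδ] at hNβ ⊢
  have hδ0 : 0 ≤ δ := by rw [hδ]; positivity
  set Λ : Set Freq := {n | n ∈ allGenerations P gen} with hΛ
  have h0Λ : (0 : Freq) ∉ allGenerations P gen := fun h => (hlat 0 h).2.2 rfl
  have hdec := hg.zeroDecoupled h0Λ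
  have hr := symbolBound_slow
  have hwΛ : ∀ t ∈ Set.Icc 0 T, SupportedIn Λ (w t) :=
    hw.supportedIn (fun _ => symbolBound_rfnls)
      (fun _ k h1 h2 h3 h => hg.rfnlsSymbol_eq_zero h1 h2 h3 h) hw0
  have hwslow : ∀ t ∈ Set.Icc 0 T,
      trilin rfnlsSymbol (w t) (w t) (w t) = trilin slowSymbol (w t) (w t) (w t) := by
    intro t ht
    refine trilin_congr fun k h1 h2 h3 => ?_
    rw [slowSymbol]
    split_ifs with ho
    · exact hg.rfnlsSymbol_eq_zero ((hwΛ t ht).mem h1) ((hwΛ t ht).mem h2) ((hwΛ t ht).mem h3)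
        (by rw [ho]; exact h0Λ)
    · rfl
  have hwwΛ : ∀ t ∈ Set.Icc 0 T, SupportedIn Λ (trilin slowSymbol (w t) (w t) (w t)) := by
    intro t ht
    rw [← hwslow t ht]
    exact supportedIn_trilin symbolBound_rfnls (hwΛ t ht) (hwΛ t ht) (hwΛ t ht)
      fun k h1 h2 h3 h => hg.rfnlsSymbol_eq_zero h1 h2 h3 h
  have hclat : ∀ t ∈ Set.Icc 0 T, SupportedIn (dilatedLattice N) (c t) := by
    refine hc.supportedIn symbolBound_fnls
      (fun _ k h1 h2 h3 h => absurd (outFreq_mem_dilatedLattice h1 h2 h3) h) fun n hn => ?_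
    have hn0 : n ≠ 0 := fun e => hn (by rw [e]; exact ⟨dvd_zero _, dvd_zero _⟩)
    rw [hcw n hn0]
    exact hw0 n fun hm => hn ⟨(hlat n hm).1, (hlat n hm).2.1⟩
  set a : ℝ → EllOne := fun t => restrict {0} (c t) with ha
  set b : ℝ → EllOne := fun t => restrict {0}ᶜ (c t) with hb
  set F : ℝ → EllOne := fun t => Complex.I • trilin (fnlsSymbol t) (c t) (c t) (c t) with hF
  have hM0 : 0 < M := by linarith
  have hFn : ∀ t ∈ Set.Icc 0 T, ‖F t‖ ≤ M ^ 3 := by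
    intro t ht
    simp only [hF]
    rw [norm_smul, Complex.norm_I, one_mul]
    refine (norm_trilin_le (symbolBound_fnls t) _ _ _).trans ?_
    have := hcM t ht
    calc 1 * (‖c t‖ * (‖c t‖ * ‖c t‖)) ≤ 1 * (M * (M * M)) := by gcongr
      _ = M ^ 3 := by ring
  have hbF : ∀ t ∈ Set.Icc 0 T, restrict {0}ᶜ (F t) = Complex.I •
      (trilin slowSymbol (c t) (c t) (c t) + trilin (fastSymbol N t) (c t) (c t) (c t)) := by
    intro t ht
    simp only [hF]
    rw [map_smul, restrict_compl_trilin_fnls t (hclat t ht)]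
  -- The nonzero modes of the time derivative are again `O(β)`; this is what gives the
  -- integration-by-parts remainder `X` its factor `β`.
  have hbFn : ∀ t ∈ Set.Icc 0 T, ‖restrict {0}ᶜ (F t)‖ ≤ 6 * M ^ 2 * β := by
    intro t ht
    have hψ : SymbolBound (fun k => if outFreq k = 0 then 0 else fnlsSymbol t k) 1 := fun k => by
      simp only []
      split_ifs
      · simp
      · exact symbolBound_fnls t k
    simp only [hF]
    rw [map_smul, norm_smul, Complex.norm_I, one_mul,
      restrict_trilin (symbolBound_fnls t) hψ (fun k hk => if_neg hk)
        (fun k hk => if_pos (not_not.1 hk))]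
    refine (norm_trilin_le_of_zero hψ (fun k k1 k2 k3 => if_pos (by simp [outFreq, k1, k2, k3]))
      _ _ _).trans ?_
    have h1 := hcM t ht
    have h2 := hbβ t ht
    calc 1 * (‖restrict {0}ᶜ (c t)‖ * (‖c t‖ * ‖c t‖) + ‖c t‖ * (‖restrict {0}ᶜ (c t)‖ * ‖c t‖) +
          ‖c t‖ * (‖c t‖ * ‖restrict {0}ᶜ (c t)‖))
        ≤ 1 * (2 * β * (M * M) + M * (2 * β * M) + M * (M * (2 * β))) := by gcongr
      _ = 6 * M ^ 2 * β := by ring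
  -- Differentiating the primitive reproduces the fast part of the derivative of `b`, which cancels
  -- exactly in `v` and leaves `X`.
  set v : ℝ → EllOne := fun t =>
    b t - Complex.I • trilin (fastPrimitive N t) (c t) (c t) (c t) with hv
  have hbv : ∀ t ∈ Set.Icc 0 T, ‖b t - v t‖ ≤ 6 * M ^ 2 * (δ * β) := by
    intro t ht
    simp only [hv]
    rw [sub_sub_cancel, norm_smul, Complex.norm_I, one_mul]
    refine (norm_fastPrimitive_triple_le hN t (hcM t ht) (hcM t ht) (hcM t ht) (hbβ t ht)
      (hbβ t ht) (hbβ t ht)).trans (le_of_eq ?_)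
    rw [hδ]; ring
  have hvβ : ∀ t ∈ Set.Icc 0 T, ‖v t‖ ≤ 3 * β := by
    intro t ht
    have h1 := norm_sub_norm_le (v t) (b t)
    rw [norm_sub_rev (v t) (b t)] at h1
    have h2 : 6 * M ^ 2 * (δ * β) ≤ 6 * M ^ 2 * (β ^ 2 * β) := by gcongr
    have h3 : 6 * M ^ 2 * β ^ 2 * β ≤ 1 * β := by gcongr
    linarith [hbv t ht, hbβ t ht]
  set X : ℝ → EllOne := fun t => trilin (fastPrimitive N t) (F t) (c t) (c t) +
    trilin (fastPrimitive N t) (c t) (F t) (c t) +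
    trilin (fastPrimitive N t) (c t) (c t) (F t) with hX
  have hXn : ∀ t ∈ Set.Icc 0 T, ‖X t‖ ≤ 30 * M ^ 4 * (δ * β) := by
    intro t ht
    have h1 := norm_fastPrimitive_triple_le hN t (hFn t ht) (hcM t ht) (hcM t ht) (hbFn t ht)
      (hbβ t ht) (hbβ t ht)
    have h2 := norm_fastPrimitive_triple_le hN t (hcM t ht) (hFn t ht) (hcM t ht) (hbβ t ht)
      (hbFn t ht) (hbβ t ht)
    have h3 := norm_fastPrimitive_triple_le hN t (hcM t ht) (hcM t ht) (hFn t ht) (hbβ t ht)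
      (hbβ t ht) (hbFn t ht)
    rw [← hδ] at h1 h2 h3
    refine norm_add₃_le.trans ((add_le_add (add_le_add h1 h2) h3).trans (le_of_eq (by ring)))
  set ρ : ℝ → EllOne := fun t => Complex.I • (trilin slowSymbol (c t) (c t) (c t) -
    (quadraticPart slowSymbol (a t) (v t) (v t) + trilin slowSymbol (v t) (v t) (v t))) -
    Complex.I • X t with hρ
  have hρn : ∀ t ∈ Set.Icc 0 T, ‖ρ t‖ ≤ 300 * M ^ 4 * (δ * β) := by
    intro t ht
    have h1 := norm_slow_sub_le hM hβ1 ((norm_restrict_le {0} (c t)).trans (hcM t ht))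
      ((hbβ t ht).trans (by linarith)) (hvβ t ht) (hbv t ht)
    rw [← trilin_slow_eq] at h1
    refine (norm_sub_le _ _).trans ?_
    rw [norm_smul, norm_smul, Complex.norm_I, one_mul, one_mul]
    have h2 : M ^ 3 * (δ * β) ≤ M ^ 4 * (δ * β) := by gcongr; norm_num
    linarith [hXn t ht]
  have hvd : ∀ t ∈ Set.Icc 0 T, HasDerivWithinAt v (Complex.I •
      (quadraticPart slowSymbol (a t) (v t) (v t) + trilin slowSymbol (v t) (v t) (v t)) + ρ t)
      (Set.Icc 0 T) t := by
    intro t ht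
    have h1 : HasDerivWithinAt b (restrict {0}ᶜ (F t)) (Set.Icc 0 T) t :=
      ((restrict {0}ᶜ).restrictScalars ℝ).hasFDerivAt.comp_hasDerivWithinAt t (hc t ht)
    have h2 := hasDerivWithinAt_trilin (symbolBound_fastPrimitive hN) (symbolBound_fast N)
      (hasDerivAt_fastPrimitive N) (hc t ht) (hc t ht) (hc t ht)
    refine (h1.sub (h2.const_smul Complex.I)).congr_deriv ?_
    rw [hbF t ht]
    simp only [hρ, hX, hF]
    module
  set μ : ℝ → EllOne := fun t => restrict {0} (F t) +
    (Complex.I * ((A ^ 2 : ℝ) : ℂ)) • a t with hμ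
  have had : ∀ t ∈ Set.Icc 0 T, HasDerivWithinAt a
      (-(Complex.I * ((A ^ 2 : ℝ) : ℂ)) • a t + μ t) (Set.Icc 0 T) t := by
    intro t ht
    have h1 : HasDerivWithinAt a (restrict {0} (F t)) (Set.Icc 0 T) t :=
      ((restrict {0}).restrictScalars ℝ).hasFDerivAt.comp_hasDerivWithinAt t (hc t ht)
    refine h1.congr_deriv ?_
    simp only [hμ]
    module
  have hmass : ∀ t ∈ Set.Icc 0 T, |A ^ 2 - ‖c t 0‖ ^ 2| ≤ 8 * β ^ 2 := by
    intro t ht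
    have := hc.abs_sq_sub_sq_le hbβ t ht
    rw [hc0] at this
    linarith
  have haA : ∀ t ∈ Set.Icc 0 T, ‖a t‖ ≤ 2 * A := by
    intro t ht
    simp only [ha]
    rw [norm_restrict_zero]
    have h1 := (abs_le.1 (hmass t ht)).1
    refine abs_le_of_sq_le_sq' ?_ (by positivity) |>.2
    nlinarith
  -- The self-interaction rotates at speed `|c₀(t)|²`. Replacing this by `A²` costs `8Mβ²` by
  -- conservation of mass; the other interactions cost `4Mβ²`.
  have hμm : ∀ t ∈ Set.Icc 0 T, ‖μ t‖ ≤ 12 * M * β ^ 2 := by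
    intro t ht
    have h1 := norm_restrict_zero_trilin_add_le t (c t)
    have h2 := hbβ t ht
    have h3 := hcM t ht
    have he : μ t = Complex.I • (restrict {0} (trilin (fnlsSymbol t) (c t) (c t) (c t)) +
        (‖c t 0‖ : ℂ) ^ 2 • a t) +
        (Complex.I * ((A ^ 2 - ‖c t 0‖ ^ 2 : ℝ) : ℂ)) • a t := by
      simp only [hμ, hF, ha]
      rw [map_smul]
      push_cast
      module
    rw [he]
    refine (norm_add_le _ _).trans ?_
    rw [norm_smul, norm_smul, norm_mul, Complex.norm_I, one_mul, one_mul, Complex.norm_real,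
      Real.norm_eq_abs]
    have h4 : ‖restrict {0}ᶜ (c t)‖ ^ 2 * ‖c t‖ ≤ (2 * β) ^ 2 * M := by gcongr
    have h5 : |A ^ 2 - ‖c t 0‖ ^ 2| * ‖a t‖ ≤ 8 * β ^ 2 * M :=
      mul_le_mul (hmass t ht) ((norm_restrict_le _ _).trans h3) (norm_nonneg _) (by positivity)
    linarith
  intro t ht
  have h00 : (0 : ℝ) ∈ Set.Icc 0 T := ⟨le_rfl, ht.1.trans ht.2⟩
  have hb0 : b 0 = w 0 := restrict_compl_eq hcw (hw0 0 h0Λ)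
  have hD0 : ‖v 0 - w 0‖ ≤ 6 * M ^ 2 * (δ * β) := by
    rw [← hb0, norm_sub_rev]
    exact hbv 0 h00
  have hmain := norm_sub_le_of_rotating hr hdec (m := 12 * M) hA hβ hβA (by linarith) had hvd
    (fun t ht => by rw [← hwslow t ht]; exact hw t ht)
    (fun t _ => supportedIn_restrict _ _)
    (fun t _ n hn => by
      simp only [hμ, ha, add_apply, smul_apply]
      rw [restrict_of_notMem hn, restrict_of_notMem hn, mul_zero, add_zero])
    hwΛ hwwΛ haA hμm hvβ hwβ hρn hD0 t ht
  have htri : ‖b t - w t‖ ≤ ‖b t - v t‖ + ‖v t - w t‖ := norm_sub_le_norm_sub_add_norm_sub _ _ _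
  have e1 : 3 / 2 * (6 * M ^ 2 * (δ * β)) = 9 * M ^ 2 * (δ * β) := by ring
  have e2 : 2 * (300 * M ^ 4 * (δ * β)) = 600 * M ^ 4 * (δ * β) := by ring
  rw [e1, e2] at hmain
  linarith [hbv t ht]

end EllOne

/-! ### Bootstrap and choice of constants. -/

theorem gronwallBound_le {δ K ε x : ℝ} (hK : 0 < K) (hε : 0 ≤ ε) :
    gronwallBound δ K ε x ≤ (δ + ε / K) * Real.exp (K * x) := by
  rw [gronwallBound_of_K_ne_0 hK.ne']
  have : 0 ≤ ε / K := by positivity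
  linarith

/-- Continuous induction: a bound that improves itself holds throughout. -/
theorem lt_of_self_improving {f : ℝ → ℝ} {T K : ℝ} (hf : ContinuousOn f (Set.Icc 0 T))
    (h0 : f 0 < K) (h : ∀ S ∈ Set.Icc 0 T, (∀ t ∈ Set.Icc 0 S, f t ≤ K) →
      ∀ t ∈ Set.Icc 0 S, f t < K) : ∀ t ∈ Set.Icc 0 T, f t < K := by
  by_contra! hcon
  obtain ⟨t₁, ht₁, hft₁⟩ := hcon
  have hcl : IsCompact (Set.Icc 0 T ∩ f ⁻¹' Set.Ici K) :=
    isCompact_Icc.of_isClosed_subset (hf.preimage_isClosed_of_isClosed isClosed_Icc isClosed_Ici)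
      Set.inter_subset_left
  -- At the first time `s` with `f s ≥ K`, the intermediate value theorem gives `f s = K`. Then `f ≤
  -- K` up to `s`, and self-improvement yields a contradiction.
  obtain ⟨s, ⟨hsT, hsK⟩, hsmin⟩ := hcl.exists_isLeast ⟨t₁, ht₁, hft₁⟩
  obtain ⟨u, hu, hfu⟩ := intermediate_value_Icc hsT.1
    (hf.mono (Set.Icc_subset_Icc_right hsT.2)) ⟨h0.le, hsK⟩
  have hus : s = u := le_antisymm (hsmin ⟨⟨hu.1, hu.2.trans hsT.2⟩, hfu.ge⟩) hu.2
  subst hus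
  refine absurd (h s hsT (fun t ht => ?_) s ⟨hsT.1, le_rfl⟩) (not_lt.2 hsK)
  rcases ht.2.lt_or_eq with hlt | heq
  · by_contra! hlt'
    exact absurd (hsmin ⟨⟨ht.1, ht.2.trans hsT.2⟩, hlt'.le⟩) (not_le.2 hlt)
  · rw [heq, hfu]

/-- Existence of a solution of `FNLS` close to the given solution of `RFNLS`. -/
theorem exists_solution_near {σ : ℝ} (hσ : 0 < σ) {A : ℂ} (hA : A ≠ 0) {M B : ℝ}
    (hM : M = 2 * ‖A‖ + 2) (hB1 : 1 < B) (hB2 : 800 ≤ ‖A‖ * B) (hB3 : 144 * M ≤ ‖A‖ ^ 2 * B)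
    (hB4 : 6 * M ^ 2 ≤ B) (hB5 : 30 * M ^ 4 < B ^ σ) {N : ℕ} (hN : B ^ (1 + σ) ≤ N) {T : ℝ}
    (hT : 0 ≤ T) (hTB : T ≤ σ / 3000 * (B ^ 2 * Real.log B)) {P : ℕ} {gen : ℕ → Finset Freq}
    (hg : IsGoodFrequencySet P gen) (hlat : ∀ n ∈ allGenerations P gen, n ∈ puncturedLattice N)
    {w : ℝ → EllOne} (hw : SolvesRFNLS T w) (hw0 : IsAdaptedData P gen (w 0))
    (hwβ : ∀ t ∈ Set.Icc 0 T, ‖w t‖ ≤ B⁻¹) :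
    ∃ c : ℝ → EllOne, EllOne.SolvesCubic fnlsSymbol T c ∧ c 0 0 = A ∧
      (∀ n : Freq, n ≠ 0 → c 0 n = w 0 n) ∧ ∀ t ∈ Set.Icc 0 T,
        ‖EllOne.restrict {0}ᶜ (c t) - w t‖ ≤ 30 * M ^ 4 * (B ^ (1 + σ) / (N : ℝ) ^ 2) := by
  have hB0 : 0 < B := by linarith
  have hA0 : 0 < ‖A‖ := norm_pos_iff.2 hA
  have hM2 : 2 < M := by linarith
  have hM0 : 0 < M := by linarith
  have hw' := EllOne.solvesCubic_of_solvesRFNLS hw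
  have h00 : (0 : ℝ) ∈ Set.Icc 0 T := ⟨le_rfl, hT⟩
  have h0Λ : (0 : Freq) ∉ allGenerations P gen := fun h => (hlat 0 h).2.2 rfl
  have hBσ1 : B ^ (1 + σ) = B * B ^ σ := by rw [Real.rpow_add hB0, Real.rpow_one]
  have hBσ0 : 1 ≤ B ^ σ := Real.one_le_rpow hB1.le hσ.le
  have hBN : B ≤ N := by
    refine le_trans ?_ hN
    rw [hBσ1]
    exact le_mul_of_one_le_right hB0.le hBσ0
  have hNpos : 0 < N := by exact_mod_cast hB0.trans_le hBN
  have hNr : (0 : ℝ) < N := by exact_mod_cast hNpos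
  obtain ⟨β, hβ⟩ : ∃ β, β = B⁻¹ := ⟨_, rfl⟩
  have hβ0 : 0 < β := hβ ▸ inv_pos.2 hB0
  have hβB : β * B = 1 := by rw [hβ]; exact inv_mul_cancel₀ hB0.ne'
  have hβ1 : β < 1 := by rw [hβ]; exact inv_lt_one_of_one_lt₀ hB1
  rw [← hβ] at hwβ
  obtain ⟨c, hc0, hc⟩ := EllOne.exists_solution_radial (φ := fnlsSymbol) (R := M) hT hM0
    symbolBound_fnls continuous_fnlsSymbol (lp.single 1 0 A + w 0)
  have hc00 : c 0 0 = A := by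
    rw [hc0, EllOne.add_apply, lp.single_apply_self, hw0.support 0 h0Λ, add_zero]
  have hc0n : ∀ n : Freq, n ≠ 0 → c 0 n = w 0 n := fun n hn => by
    rw [hc0, EllOne.add_apply, lp.single_apply_ne _ _ _ hn, zero_add]
  -- While `‖c‖ ≤ M` the truncation is inactive, so `c` solves the true equation and the comparison
  -- applies.
  have key : ∀ S ∈ Set.Icc 0 T, (∀ t ∈ Set.Icc 0 S, ‖c t‖ ≤ M) →
      (∀ t ∈ Set.Icc 0 S, ‖EllOne.restrict {0}ᶜ (c t)‖ ≤ 2 * β) →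
      EllOne.SolvesCubic fnlsSymbol S c ∧ ∀ t ∈ Set.Icc 0 S,
        ‖EllOne.restrict {0}ᶜ (c t) - w t‖ ≤ 30 * M ^ 4 * (B ^ (1 + σ) / (N : ℝ) ^ 2) := by
    intro S hS hcM hbβ
    have hsub : Set.Icc 0 S ⊆ Set.Icc 0 T := Set.Icc_subset_Icc_right hS.2
    have hcS : EllOne.SolvesCubic fnlsSymbol S c := by
      intro t ht
      have := (hc t (hsub ht)).mono hsub
      rwa [radialRetraction_of_norm_le hM0 (hcM t ht)] at this
    refine ⟨hcS, fun t ht => ?_⟩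
    have hβ2 : 1 / (N : ℝ) ^ 2 ≤ β ^ 2 := by
      rw [hβ, inv_pow, one_div]
      gcongr
    have hest := EllOne.norm_restrict_compl_sub_le hg hNpos hlat hA0 (by linarith) hβ0 hβ1.le
      (by nlinarith) (by nlinarith) (by nlinarith) hβ2 hcS
      (fun t ht => (hw' t (hsub ht)).mono hsub) (by rw [hc00]) hc0n
      (fun n hn => hw0.support n hn) (fun t ht => hwβ t (hsub ht)) hcM hbβ t ht
    refine hest.trans ?_
    obtain ⟨δ, hδ⟩ : ∃ δ, δ = 1 / (N : ℝ) ^ 2 := ⟨_, rfl⟩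
    have hδ0 : 0 ≤ δ := by rw [hδ]; positivity
    have hexp : Real.exp (3000 * β ^ 2 * t) ≤ B ^ σ := by
      rw [Real.rpow_def_of_pos hB0]
      refine Real.exp_le_exp.2 ?_
      have h1 : t ≤ σ / 3000 * (B ^ 2 * Real.log B) := (ht.2.trans hS.2).trans hTB
      calc 3000 * β ^ 2 * t ≤ 3000 * β ^ 2 * (σ / 3000 * (B ^ 2 * Real.log B)) := by gcongr
        _ = (β * B) ^ 2 * (Real.log B * σ) := by ring
        _ = Real.log B * σ := by rw [hβB]; ring
    have hgr := gronwallBound_le (δ := 9 * M ^ 2 * (δ * β)) (K := 3000 * β ^ 2)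
      (ε := 600 * M ^ 4 * (δ * β)) (x := t) (by positivity) (by positivity)
    have hdiv : 600 * M ^ 4 * (δ * β) / (3000 * β ^ 2) = 1 / 5 * M ^ 4 * (δ * B) := by
      rw [hβ]
      field_simp
      ring
    rw [hdiv] at hgr
    have hMM : M ^ 2 ≤ M ^ 4 := by gcongr <;> [linarith; norm_num]
    have hδβ : M ^ 2 * (δ * β) ≤ M ^ 4 * (δ * B) := by
      have : β ≤ B := by linarith
      gcongr
    have h2 : (9 * M ^ 2 * (δ * β) + 1 / 5 * M ^ 4 * (δ * B)) * Real.exp (3000 * β ^ 2 * t) ≤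
        (10 * (M ^ 4 * (δ * B))) * B ^ σ := by
      have hp : 0 ≤ M ^ 4 * (δ * B) := by positivity
      refine mul_le_mul (by linarith) hexp (Real.exp_pos _).le (by positivity)
    have h3 : M ^ 4 * (δ * B) ≤ M ^ 4 * (δ * B) * B ^ σ :=
      le_mul_of_one_le_right (by positivity) hBσ0
    have h4 : 30 * M ^ 4 * (B ^ (1 + σ) / (N : ℝ) ^ 2) = 30 * (M ^ 4 * (δ * B) * B ^ σ) := by
      rw [hBσ1, hδ]; ring
    have h5 : 0 ≤ M ^ 4 * (δ * B) * B ^ σ := by positivity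
    rw [h4, ← hδ]
    linarith
  -- From `B^(1+σ) ≤ N` the error is at most `30 M⁴ B^(-1-σ)`, and `B^σ` absorbs the constant.
  have hsmall : 30 * M ^ 4 * (B ^ (1 + σ) / (N : ℝ) ^ 2) < β := by
    have h1 : B ^ (1 + σ) / (N : ℝ) ^ 2 ≤ (B ^ (1 + σ))⁻¹ := by
      have hp : 0 < B ^ (1 + σ) := by positivity
      rw [div_le_iff₀ (by positivity), inv_mul_eq_div, le_div_iff₀ hp, ← sq]
      gcongr
    have h2 : 30 * M ^ 4 * (B ^ (1 + σ))⁻¹ < B ^ σ * (B ^ (1 + σ))⁻¹ := by gcongr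
    have h3 : B ^ σ * (B ^ (1 + σ))⁻¹ = β := by
      rw [hBσ1, hβ]
      field_simp
    have h4 : 30 * M ^ 4 * (B ^ (1 + σ) / (N : ℝ) ^ 2) ≤ 30 * M ^ 4 * (B ^ (1 + σ))⁻¹ := by
      gcongr
    linarith
  have hcont : ContinuousOn c (Set.Icc 0 T) := fun t ht => (hc t ht).continuousWithinAt
  have hbcont : ContinuousOn (fun t => EllOne.restrict {0}ᶜ (c t)) (Set.Icc 0 T) :=
    (EllOne.restrict {0}ᶜ).continuous.comp_continuousOn hcont
  -- Both bootstrap bounds, `M` for `c` and `2β` for its nonzero modes, are normalised and run as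
  -- one.
  have hlt := lt_of_self_improving (K := 1)
    (f := fun t => max (‖c t‖ / M) (‖EllOne.restrict {0}ᶜ (c t)‖ / (2 * β)))
    (continuous_max.comp_continuousOn
      ((hcont.norm.div_const _).prodMk (hbcont.norm.div_const _))) ?_ ?_
  · have h1 : ∀ t ∈ Set.Icc 0 T, ‖c t‖ ≤ M := fun t ht =>
      (div_le_one hM0).1 ((le_max_left _ _).trans (hlt t ht).le)
    have h2 : ∀ t ∈ Set.Icc 0 T, ‖EllOne.restrict {0}ᶜ (c t)‖ ≤ 2 * β := fun t ht =>
      (div_le_one (by positivity)).1 ((le_max_right _ _).trans (hlt t ht).le)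
    obtain ⟨k1, k2⟩ := key T ⟨hT, le_rfl⟩ h1 h2
    exact ⟨c, k1, hc00, hc0n, k2⟩
  · have hb0 : EllOne.restrict {0}ᶜ (c 0) = w 0 :=
      EllOne.restrict_compl_eq hc0n (hw0.support 0 h0Λ)
    have hn := EllOne.norm_le_of_restrict (c 0)
    rw [hb0, hc00] at hn
    have := hwβ 0 h00
    refine max_lt ((div_lt_one hM0).2 (by linarith)) ((div_lt_one (by positivity)).2 ?_)
    rw [hb0]
    linarith
  · intro S hS hle t ht
    have h1 : ∀ t ∈ Set.Icc 0 S, ‖c t‖ ≤ M := fun t ht =>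
      (div_le_one hM0).1 ((le_max_left _ _).trans (hle t ht))
    have h2 : ∀ t ∈ Set.Icc 0 S, ‖EllOne.restrict {0}ᶜ (c t)‖ ≤ 2 * β := fun t ht =>
      (div_le_one (by positivity)).1 ((le_max_right _ _).trans (hle t ht))
    obtain ⟨k1, k2⟩ := key S hS h1 h2
    have hb : ‖EllOne.restrict {0}ᶜ (c t)‖ < 2 * β := by
      have e1 := norm_sub_norm_le (EllOne.restrict {0}ᶜ (c t)) (w t)
      have e2 := hwβ t ⟨ht.1, ht.2.trans hS.2⟩
      linarith [k2 t ht]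
    have hm := (abs_le.1 (k1.abs_sq_sub_sq_le h2 t ht)).1
    rw [hc00] at hm
    have hβA : 800 * β ≤ ‖A‖ := by nlinarith
    -- Mass conservation keeps `|c₀|` below `2|A|`; with `β < 1`, the choice `M = 2|A| + 2` leaves
    -- strict room for the nonzero modes.
    have hct0 : ‖c t 0‖ ≤ 2 * ‖A‖ := abs_le_of_sq_le_sq' (by nlinarith) (by positivity) |>.2
    have hcn := EllOne.norm_le_of_restrict (c t)
    exact max_lt ((div_lt_one hM0).2 (by linarith)) ((div_lt_one (by positivity)).2 hb)

theorem lemma3p1 (σ : ℝ) (hσ0 : 0 < σ) (hσ1 : σ < 1) :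
    ∃ κ : ℝ, 0 < κ ∧ ∃ ε : ℝ, 0 < ε ∧ ∀ A : ℂ, A ≠ 0 → ∃ B₀ : ℝ, ∃ C : ℝ,
      ∀ (B : ℝ) (N : ℕ) (T : ℝ), B₀ ≤ B → B ^ (1 + σ) ≤ κ * (N : ℝ) →
        0 ≤ T → T ≤ ε * (B ^ 2 * Real.log B) →
      ∀ (P : ℕ) (gen : ℕ → Finset Freq), IsGoodFrequencySet P gen →
        (∀ n ∈ allGenerations P gen, n ∈ puncturedLattice N) →
      ∀ ct : ℝ → EllOne, SolvesRFNLS T ct → IsAdaptedData P gen (ct 0) →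
        (∀ t ∈ Set.Icc 0 T, ‖ct t‖ ≤ B⁻¹) →
        (∃ c : ℝ → EllOne, SolvesFNLS T c ∧ c 0 0 = A ∧ ∀ n : Freq, n ≠ 0 → c 0 n = ct 0 n) ∧
        ∀ c : ℝ → EllOne, SolvesFNLS T c → c 0 0 = A →
          (∀ n : Freq, n ≠ 0 → c 0 n = ct 0 n) →
          ∀ t ∈ Set.Icc 0 T,
            ∑ n ∈ allGenerations P gen, ‖c t n - ct t n‖ ≤ C * (B ^ (1 + σ) / (N : ℝ) ^ 2) := by
  -- With `ε = σ/3000` the Gronwall factor at rate `3000/B²` is at most `B^σ`.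
  refine ⟨1, one_pos, σ / 3000, by positivity, fun A hA => ?_⟩
  have hA0 : 0 < ‖A‖ := norm_pos_iff.2 hA
  obtain ⟨M, hM⟩ : ∃ M, M = 2 * ‖A‖ + 2 := ⟨_, rfl⟩
  have hlarge : ∀ᶠ B : ℝ in atTop, 1 < B ∧ 800 ≤ ‖A‖ * B ∧ 144 * M ≤ ‖A‖ ^ 2 * B ∧
      6 * M ^ 2 ≤ B ∧ 30 * M ^ 4 < B ^ σ :=
    (eventually_gt_atTop 1).and (((tendsto_id.const_mul_atTop hA0).eventually_ge_atTop _).and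
      (((tendsto_id.const_mul_atTop (by positivity)).eventually_ge_atTop _).and
      ((eventually_ge_atTop _).and ((tendsto_rpow_atTop hσ0).eventually_gt_atTop _))))
  obtain ⟨B₀, hB₀⟩ := eventually_atTop.1 hlarge
  refine ⟨B₀, 30 * M ^ 4, fun B N T hB hBN hT hTB P gen hg hlat ct hct had hctB => ?_⟩
  obtain ⟨b1, b2, b3, b4, b5⟩ := hB₀ B hB
  rw [one_mul] at hBN
  obtain ⟨c, hc, hc0, hcn, hcb⟩ := exists_solution_near hσ0 hA hM b1 b2 b3 b4 b5 hBN hT hTB hg hlat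
    hct had hctB
  refine ⟨⟨c, EllOne.solvesFNLS_iff.2 hc, hc0, hcn⟩, fun d hd hd0 hdn t ht => ?_⟩
  have hinit : d 0 = c 0 := EllOne.ext_apply fun n => by
    by_cases hn : n = 0
    · rw [hn, hd0, hc0]
    · rw [hdn n hn, hcn n hn]
  rw [(EllOne.solvesFNLS_iff.1 hd).unique symbolBound_fnls hc hinit t ht]
  refine le_trans ?_ ((EllOne.sum_norm_le _ (allGenerations P gen)).trans (hcb t ht))
  refine le_of_eq (Finset.sum_congr rfl fun n hn => ?_)
  have hn0 : n ∈ ({0} : Set Freq)ᶜ := fun h => (hlat n hn).2.2 h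
  rw [EllOne.sub_apply, EllOne.restrict_of_mem hn0]
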